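/- Let $2<p\le 4$, let $f\in L_p(\mathbb R)$ (real scalars), and let $(\lambda_i)_{i\in\mathbb N}$ be a sequence of real numbers. Put $f_i=T_{\lambda_i}f$, where $T_\lambda f(x)=f(x-\lambda)$, and assume that $(f_i)$ is an unconditional basic sequence in $L_p(\mathbb R)$, i.e. an unconditional Schauder basis of its closed linear span. Let $(h_j)_{j\ge 0}$ be the $L_p$-normalized Haar basis of $L_p[0,1]$ (including the constant function), and for $m\in\mathbb Z$ let $h^{(m)}_j(x)=h_j(x-m)$ be its translate to $[m,m+1]$. Then, for every enumeration of the system $(h^{(m)}_j)_{m\in\mathbb Z,\,j\ge 0}$ as a sequence, there is a basic sequence $(g_i)$ in $L_p(\mathbb R)$ such that 1. $(g_i)$ is equivalent to $(f_i)$, i.e. there are constants $c,C>0$ with $c\,\|\sum_i a_if_i\|_p\le\|\sum_i a_ig_i\|_p\le C\,\|\sum_i a_if_i\|_p$ for all finitely supported real sequences $(a_i)$; 2. $(g_i)$ is a block basis of the enumerated Haar system, i.e. the $g_i$ are nonzero finite linear combinations of its members over successive, pairwise disjoint intervals of indices; 3. with $Y=\overline{\mathrm{span}}\{g_i: i\in\mathbb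 N\}$, for every bounded interval $I\subseteq\mathbb R$ the restriction operator $T_I:Y\to L_p(I)$, $y\mapsto y|_I$, is compact. -/

import Mathlib

open MeasureTheory
open scoped ENNReal

/-- The closed linear span of a sequence. -/
def closedSpan {X : Type*} [NormedAddCommGroup X] [NormedSpace ℝ X] (x : ℕ → X) :
    Submodule ℝ X :=
  (Submodule.span ℝ (Set.range x)).topologicalClosure

/-- `x` is a basic sequence: a Schauder basis of its closed linear span. -/
def IsBasicSeq {X : Type*} [NormedAddCommGroup X] [NormedSpace ℝ X] (x : ℕ → X) : Prop :=
  ∃ b : SchauderBasis ℝ (closedSpan x), ∀ i, ((b.basis i : closedSpan x) : X) = x i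

/-- `x` is an unconditional basic sequence: an unconditional Schauder basis of its closed
linear span. -/
def IsUnconditionalBasicSeq {X : Type*} [NormedAddCommGroup X] [NormedSpace ℝ X]
    (x : ℕ → X) : Prop :=
  ∃ b : UnconditionalSchauderBasis ℕ ℝ (closedSpan x),
    ∀ i, ((b.basis i : closedSpan x) : X) = x i

/-- Equivalence of sequences: the linear extension of `x i ↦ y i` is well defined and an
isomorphism between the linear spans (hence between the closed linear spans). -/
def SeqEquiv {X Y : Type*} [NormedAddCommGroup X] [NormedSpace ℝ X]
    [NormedAddCommGroup Y] [NormedSpace ℝ Y] (x : ℕ → X) (y : ℕ → Y) : Prop :=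
  ∃ c C : ℝ, 0 < c ∧ 0 < C ∧ ∀ (s : Finset ℕ) (a : ℕ → ℝ),
    c * ‖∑ i ∈ s, a i • x i‖ ≤ ‖∑ i ∈ s, a i • y i‖ ∧
      ‖∑ i ∈ s, a i • y i‖ ≤ C * ‖∑ i ∈ s, a i • x i‖

/-- `g` is a block basis of `h`: its terms are nonzero linear combinations of `h` over
successive disjoint intervals of indices. -/
def IsBlockBasisOf {X : Type*} [NormedAddCommGroup X] [NormedSpace ℝ X]
    (g h : ℕ → X) : Prop :=
  ∃ (n : ℕ → ℕ) (a : ℕ → ℝ), StrictMono n ∧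
    ∀ i, g i ≠ 0 ∧ g i = ∑ j ∈ Finset.Ico (n i) (n (i + 1)), a j • h j

/-- The translation operator `(T_t f) x = f (x - t)` on `L_p(ℝ)`. -/
noncomputable def translateLp (p : ℝ≥0∞) (t : ℝ) (f : Lp ℝ p (volume : Measure ℝ)) :
    Lp ℝ p (volume : Measure ℝ) :=
  Lp.compMeasurePreserving (fun x : ℝ => x - t) (measurePreserving_sub_right volume t) f

/-- The function equal to `c` on `[a, b)` and to `0` elsewhere. -/
noncomputable def stepLp (p : ℝ≥0∞) (a b c : ℝ) : Lp ℝ p (volume : Measure ℝ) :=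
  indicatorConstLp p (measurableSet_Ico : MeasurableSet (Set.Ico a b))
    (measure_Ico_lt_top (μ := (volume : Measure ℝ))).ne c

/-- The `L_p`-normalized Haar basis of `L_p[0,1]`, translated to `[m, m + 1]`. The function with
index `0` is constant; the one with index `j = 2 ^ k + l`, where `0 ≤ l < 2 ^ k`, lives on the
dyadic interval `[m + l / 2 ^ k, m + (l + 1) / 2 ^ k)`, positive on its left half and negative on
its right half. -/
noncomputable def haarLp (p : ℝ≥0∞) (m : ℤ) (j : ℕ) : Lp ℝ p (volume : Measure ℝ) :=
  if j = 0 then stepLp p m (m + 1) 1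
  else
    let k : ℕ := Nat.log 2 j
    let l : ℝ := (j : ℝ) - 2 ^ k
    let c : ℝ := (2 : ℝ) ^ ((k : ℝ) / p.toReal)
    stepLp p (m + l / 2 ^ k) (m + (l + 1 / 2) / 2 ^ k) c
      - stepLp p (m + (l + 1 / 2) / 2 ^ k) (m + (l + 1) / 2 ^ k) c

/-- The restriction operator `Y → L_p(I)`, `y ↦ y|_I`, on a subspace `Y` of `L_p(ℝ)`. -/
noncomputable def restrictionOp (p : ℝ≥0∞) [Fact (1 ≤ p)] (I : Set ℝ)
    (Y : Submodule ℝ (Lp ℝ p (volume : Measure ℝ))) :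
    Y →L[ℝ] Lp ℝ p ((volume : Measure ℝ).restrict I) :=
  (LpToLpRestrictCLM ℝ ℝ ℝ volume p I).comp Y.subtypeL

/-!
Write `f_i` for the translates and `q = p.toReal`. Because `(f_i)` is unconditional, the norm of
`∑ a_i f_i` is equivalent to that of `∑ ± a_i f_i` for every choice of signs, hence to the `L_p`
norm of `∑ ε_i a_i u_i` on the product of the line with a probability space carrying independent
random signs `ε_i`; here `u_i` is a boundedly supported dyadic step function very close to `f_i`
(`norm_sum_signOf_perturb`). The point is that this random sequence can be realized exactly by
blocks of the Haar system, so that no square function inequality for Haar series is needed.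

To do so, choose rapidly increasing levels `N_i`, use the binary digit of level `N_i` of `x` as the
sign `ε_i`, and evaluate `u_i` at the point obtained from `x` by deleting the digits
`N_0, …, N_{i-1}`. Deleting a digit leaves a point which is again uniformly distributed and
independent of the digit (`lintegral_deleteDigit`), and it does not change the integer part; so on
every union of unit intervals the sequence `g_i = modulate N u i` has the same joint distribution as
`(ε_i u_i)` (`lintegral_modulate`, `norm_rpow_sum_modulate`). If `N_i` exceeds the levels of the
digits which the first factor of `g_i` reads, then `g_i` is a finite combination of Haar functions
of level `N_i` (`sum_haarCoeff_smul_haarLp_coeFn`), and these come late in any given enumeration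
when `N_i` is large (`exists_levels`). This gives the block basis and its equivalence with `(f_i)`;
it is basic by Grünblum's criterion (`isBasicSeq_of_norm_sum_range_le`).

For the compactness of the restriction to a bounded interval, contained in `J = [-M, M)`, it
suffices to bound the norms on tails of `(g_i)` (`IsBasicSeq.isCompactOperator`). The type 2
inequality of `L_p` (`sum_signOf_norm_rpow_le`) and the Cauchy–Schwarz inequality bound the square
of the norm on `J` of `∑_{i ≥ n} a_i g_i` by a multiple of
`(∑ a_i ^ 4) ^ (1/2) * (∑_{i ≥ n} ‖u_i|_J‖ ^ 4) ^ (1/2)`. By the cotype inequality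
(`sum_norm_rpow_le_sum_signOf`) the `ℓ_q` norm of the coefficients is at most a multiple of
`‖∑ a_i g_i‖`, and so is their `ℓ_4` norm as `q ≤ 4`. The last factor tends to zero: the
shifts are uniformly separated because a basic sequence is (`exists_separation`), so the
intervals `J - lam i` overlap boundedly and `∑ ‖f_i|_J‖ ^ q` is finite
(`exists_sum_norm_restrict_translateLp_le`).
-/

/-! ### Basic sequences -/

section BasicSequences

variable {X : Type*} [NormedAddCommGroup X] [NormedSpace ℝ X]

/-- The sign pattern attached to a set `t` of indices: `1` on `t` and `-1` off `t`. -/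
def signOf (t : Finset ℕ) (i : ℕ) : ℝ := if i ∈ t then 1 else -1

theorem mem_closedSpan (x : ℕ → X) (i : ℕ) : x i ∈ closedSpan x :=
  Submodule.le_topologicalClosure _ (Submodule.subset_span ⟨i, rfl⟩)

theorem IsUnconditionalBasicSeq.ne_zero {x : ℕ → X} (hx : IsUnconditionalBasicSeq x) (i : ℕ) :
    x i ≠ 0 := by
  obtain ⟨b, hb⟩ := hx
  rw [← hb i]
  have := b.linearIndependent.ne_zero i
  simpa using this

/-- Uniform boundedness of the coordinate projections of an unconditional basic sequence. -/
theorem IsUnconditionalBasicSeq.exists_norm_sum_le [CompleteSpace X] {x : ℕ → X}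
    (hx : IsUnconditionalBasicSeq x) :
    ∃ K : ℝ, 0 < K ∧ ∀ (s A : Finset ℕ) (a : ℕ → ℝ), A ⊆ s →
      ‖∑ i ∈ A, a i • x i‖ ≤ K * ‖∑ i ∈ s, a i • x i‖ := by
  classical
  obtain ⟨b, hb⟩ := hx
  have : CompleteSpace (closedSpan x) :=
    (Submodule.isClosed_topologicalClosure _).completeSpace_coe
  obtain ⟨C, hC⟩ := b.exists_norm_proj_le
  refine ⟨max C 1, by positivity, fun s A a hA => ?_⟩
  set y : closedSpan x := ∑ i ∈ s, a i • b.basis i with hy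
  have hyx : ((y : closedSpan x) : X) = ∑ i ∈ s, a i • x i := by
    simp [hy, hb]
  have hP : ((b.proj A y : closedSpan x) : X) = ∑ i ∈ A, a i • x i := by
    have : b.proj A y = ∑ i ∈ A, a i • b.basis i := by
      rw [hy, map_sum, ← Finset.sum_subset hA]
      · refine Finset.sum_congr rfl fun i hi => ?_
        rw [map_smul, b.proj_apply_basis_mem, if_pos hi]
      · intro i _ hi
        rw [map_smul, b.proj_apply_basis_mem, if_neg hi, smul_zero]
    rw [this]
    simp [hb]
  calc ‖∑ i ∈ A, a i • x i‖ = ‖b.proj A y‖ := by rw [← hP]; rfl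
    _ ≤ ‖b.proj A‖ * ‖y‖ := (b.proj A).le_opNorm y
    _ ≤ max C 1 * ‖y‖ := by gcongr; exact (hC A).trans (le_max_left _ _)
    _ = _ := by rw [← hyx]; rfl

/-- A bound for all coordinate projections of a finite sum bounds all its sign changes. -/
theorem norm_sum_signOf_le {x : ℕ → X} {K : ℝ}
    (hK : ∀ (s A : Finset ℕ) (a : ℕ → ℝ), A ⊆ s →
      ‖∑ i ∈ A, a i • x i‖ ≤ K * ‖∑ i ∈ s, a i • x i‖)
    (s t : Finset ℕ) (a : ℕ → ℝ) :
    ‖∑ i ∈ s, (a i * signOf t i) • x i‖ ≤ 2 * K * ‖∑ i ∈ s, a i • x i‖ := by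
  classical
  have h : ∑ i ∈ s, (a i * signOf t i) • x i
      = ∑ i ∈ s.filter (· ∈ t), a i • x i - ∑ i ∈ s.filter (· ∉ t), a i • x i := by
    rw [← Finset.sum_filter_add_sum_filter_not s (· ∈ t), sub_eq_add_neg, ← Finset.sum_neg_distrib]
    congr 1 <;> refine Finset.sum_congr rfl fun i hi => ?_
    · simp [signOf, (Finset.mem_filter.mp hi).2]
    · simp [signOf, (Finset.mem_filter.mp hi).2]
  rw [h]
  calc _ ≤ ‖∑ i ∈ s.filter (· ∈ t), a i • x i‖ + ‖∑ i ∈ s.filter (· ∉ t), a i • x i‖ :=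
        norm_sub_le _ _
    _ ≤ K * ‖∑ i ∈ s, a i • x i‖ + K * ‖∑ i ∈ s, a i • x i‖ :=
        add_le_add (hK _ _ _ (Finset.filter_subset _ _)) (hK _ _ _ (Finset.filter_subset _ _))
    _ = _ := by ring

/-- Grünblum's criterion. The coordinate functionals come from the Hahn–Banach theorem. -/
theorem isBasicSeq_of_norm_sum_range_le {x : ℕ → X} (hx : ∀ i, x i ≠ 0) {K : ℝ} (hK0 : 0 < K)
    (hK : ∀ (m n : ℕ) (a : ℕ → ℝ), m ≤ n →
      ‖∑ i ∈ Finset.range m, a i • x i‖ ≤ K * ‖∑ i ∈ Finset.range n, a i • x i‖) :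
    IsBasicSeq x := by
  classical
  have hcoef : ∀ (n i : ℕ) (a : ℕ → ℝ), i < n →
      ‖a i‖ ≤ 2 * K / ‖x i‖ * ‖∑ i ∈ Finset.range n, a i • x i‖ := by
    intro n i a hi
    have h1 := hK (i + 1) n a hi
    have h2 := hK i n a hi.le
    have h3 : a i • x i = ∑ j ∈ Finset.range (i + 1), a j • x j
        - ∑ j ∈ Finset.range i, a j • x j := by
      rw [Finset.sum_range_succ]; abel
    have h4 : ‖a i‖ * ‖x i‖ ≤ 2 * K * ‖∑ i ∈ Finset.range n, a i • x i‖ := by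
      rw [← norm_smul, h3]
      refine (norm_sub_le _ _).trans ?_
      linarith
    rw [div_mul_eq_mul_div, le_div_iff₀ (norm_pos_iff.mpr (hx i))]
    exact h4
  have hli : LinearIndependent ℝ x := by
    rw [linearIndependent_iff']
    intro s g hg i hi
    obtain ⟨n, hn⟩ := s.exists_nat_subset_range
    have := hcoef n i (fun j => if j ∈ s then g j else 0) (Finset.mem_range.mp (hn hi))
    have h0 : ∑ j ∈ Finset.range n, (if j ∈ s then g j else 0) • x j = 0 := by
      rw [← hg, ← Finset.sum_subset hn]
      · exact Finset.sum_congr rfl fun j hj => by simp [hj]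
      · intro j _ hj; simp [hj]
    rw [h0] at this
    simpa [hi] using this
  -- every element of the span is a finite sum over an initial segment
  have hrep : ∀ z ∈ Submodule.span ℝ (Set.range x), ∃ (n : ℕ) (a : ℕ → ℝ),
      (∀ i, n ≤ i → a i = 0) ∧ z = ∑ i ∈ Finset.range n, a i • x i := by
    intro z hz
    obtain ⟨c, rfl⟩ := (Finsupp.mem_span_range_iff_exists_finsupp).mp hz
    obtain ⟨n, hn⟩ := c.support.exists_nat_subset_range
    refine ⟨n, c, fun i hi => ?_, ?_⟩
    · by_contra h
      exact absurd (Finset.mem_range.mp (hn (Finsupp.mem_support_iff.mpr h))) (by omega)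
    · rw [Finsupp.sum_of_support_subset c hn]
      simp
  have hex : ∀ i, ∃ φ : StrongDual ℝ X, ∀ j, φ (x j) = if i = j then 1 else 0 := by
    intro i
    set S := Submodule.span ℝ (Set.range x)
    have hrx : ∀ j (h : x j ∈ S), hli.repr ⟨x j, h⟩ = Finsupp.single j 1 := fun j h =>
      hli.repr_eq_single j _ rfl
    let φ₀ : S →ₗ[ℝ] ℝ := (Finsupp.lapply i).comp hli.repr
    have hφ₀ : ∀ j (h : x j ∈ S), φ₀ ⟨x j, h⟩ = if i = j then 1 else 0 := by
      intro j h
      simp [φ₀, hrx, Finsupp.single_apply, eq_comm]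
    have hb : ∀ z : S, ‖φ₀ z‖ ≤ 2 * K / ‖x i‖ * ‖z‖ := by
      rintro ⟨z, hz⟩
      obtain ⟨n, a, ha, rfl⟩ := hrep z hz
      have hval : φ₀ ⟨∑ j ∈ Finset.range n, a j • x j, hz⟩ = a i := by
        have : (⟨∑ j ∈ Finset.range n, a j • x j, hz⟩ : S)
            = ∑ j ∈ Finset.range n, a j • (⟨x j, Submodule.subset_span ⟨j, rfl⟩⟩ : S) := by
          ext; simp
        rw [this, map_sum]
        simp only [map_smul, hφ₀, smul_eq_mul, mul_ite, mul_one, mul_zero]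
        rw [Finset.sum_ite_eq]
        split_ifs with h
        · rfl
        · exact (ha i (by simpa using h)).symm
      rw [hval]
      by_cases hi : i < n
      · exact hcoef n i a hi
      · rw [ha i (not_lt.mp hi), norm_zero]; positivity
    obtain ⟨φ, hφ, -⟩ := exists_extension_norm_eq S (φ₀.mkContinuous _ hb)
    refine ⟨φ, fun j => ?_⟩
    have := hφ ⟨x j, Submodule.subset_span ⟨j, rfl⟩⟩
    simp only at this
    rw [this, LinearMap.mkContinuous_apply, hφ₀]
  choose φ hφ using hex
  -- partial sum projections
  have hPspan : ∀ (n : ℕ) (a : ℕ → ℝ) (m : ℕ), (∀ i, n ≤ i → a i = 0) →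
      ∑ i ∈ Finset.range m, φ i (∑ j ∈ Finset.range n, a j • x j) • x i
        = ∑ i ∈ Finset.range m, a i • x i := by
    intro n a m ha
    refine Finset.sum_congr rfl fun i _ => ?_
    congr 1
    rw [map_sum]
    simp only [map_smul, hφ, smul_eq_mul, mul_ite, mul_one, mul_zero]
    rw [Finset.sum_ite_eq]
    split_ifs with h
    · rfl
    · exact (ha i (by simpa using h)).symm
  have hstab : ∀ (n : ℕ) (a : ℕ → ℝ) (m : ℕ), (∀ i, n ≤ i → a i = 0) → n ≤ m →
      ∑ i ∈ Finset.range m, a i • x i = ∑ i ∈ Finset.range n, a i • x i := by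
    intro n a m ha hm
    symm
    refine Finset.sum_subset (Finset.range_mono hm) fun i _ hi => ?_
    rw [ha i (by simpa using hi), zero_smul]
  -- the bound on the span extends to the closed span by continuity
  have hbound : ∀ m, ∀ y ∈ closedSpan x,
      ‖∑ i ∈ Finset.range m, φ i y • x i‖ ≤ K * ‖y‖ := by
    intro m y hy
    have hcl : IsClosed {y : X | ‖∑ i ∈ Finset.range m, φ i y • x i‖ ≤ K * ‖y‖} :=
      isClosed_le (by fun_prop) (by fun_prop)
    refine closure_minimal (fun z hz => ?_) hcl hy
    obtain ⟨n, a, ha, rfl⟩ := hrep z hz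
    rw [Set.mem_ofPred_eq, hPspan n a m ha, ← hstab n a (max m n) ha (le_max_right _ _)]
    exact hK _ _ _ (le_max_left _ _)
  have htend : ∀ y ∈ closedSpan x,
      Filter.Tendsto (fun m => ∑ i ∈ Finset.range m, φ i y • x i) Filter.atTop (nhds y) := by
    intro y hy
    rw [Metric.tendsto_atTop]
    intro ε hε
    have hε' : 0 < ε / (K + 2) := by positivity
    obtain ⟨z, hz, hyz⟩ := Metric.mem_closure_iff.mp hy _ hε'
    have hzc : z ∈ closedSpan x := Submodule.le_topologicalClosure _ hz
    obtain ⟨n, a, ha, rfl⟩ := hrep z hz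
    refine ⟨n, fun m hm => ?_⟩
    set z := ∑ i ∈ Finset.range n, a i • x i
    have h1 := hbound m _ ((closedSpan x).sub_mem hy hzc)
    have h2 : ∑ i ∈ Finset.range m, φ i z • x i = z := by
      rw [hPspan n a m ha, hstab n a m ha hm]
    have h3 : ∑ i ∈ Finset.range m, φ i y • x i - y
        = ∑ i ∈ Finset.range m, φ i (y - z) • x i - (y - z) := by
      simp only [map_sub, sub_smul, Finset.sum_sub_distrib, h2]; abel
    rw [dist_eq_norm] at hyz ⊢
    rw [h3]
    calc _ ≤ _ := norm_sub_le _ _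
      _ ≤ K * ‖y - z‖ + ‖y - z‖ := by gcongr
      _ < (K + 2) * (ε / (K + 2)) := by nlinarith [norm_nonneg (y - z)]
      _ = ε := by field_simp
  refine ⟨{ basis := fun i => ⟨x i, mem_closedSpan x i⟩
            coord := fun i => (φ i).comp (closedSpan x).subtypeL
            ortho := fun i j => ?_
            expansion := fun y => ?_ }, fun i => rfl⟩
  · simp [hφ, Pi.single_apply]
  · rw [HasSum, SummationFilter.conditional_filter_eq_map_range, Filter.tendsto_map'_iff,
      tendsto_subtype_rng]
    refine (htend y y.2).congr fun m => ?_
    simp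

end BasicSequences

/-! ### Binary digits and their deletion -/

section Dyadic

/-- `F` is constant on every dyadic interval `[k / 2 ^ N, (k + 1) / 2 ^ N)`. -/
def DyadicConst {α : Type*} (N : ℕ) (F : ℝ → α) : Prop :=
  ∀ x y : ℝ, ⌊(2 : ℝ) ^ N * x⌋ = ⌊(2 : ℝ) ^ N * y⌋ → F x = F y

/-- The Rademacher function of level `N`: `1` on the left halves and `-1` on the right halves of
the dyadic intervals of length `2⁻ᴺ`. -/
noncomputable def rademacher (N : ℕ) (x : ℝ) : ℝ :=
  if Even ⌊(2 : ℝ) ^ (N + 1) * x⌋ then 1 else -1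

/-- The map deleting the binary digit of level `N` (the one read by `rademacher N`): on each
dyadic interval of length `2⁻ᴺ` it stretches both halves affinely onto the whole interval. -/
noncomputable def deleteDigit (N : ℕ) (x : ℝ) : ℝ :=
  2 * x + ((⌊(2 : ℝ) ^ N * x⌋ : ℝ) - ⌊(2 : ℝ) ^ (N + 1) * x⌋) / 2 ^ N

theorem floor_two_pow_eq_ediv_two (N : ℕ) (x : ℝ) :
    ⌊(2 : ℝ) ^ N * x⌋ = ⌊(2 : ℝ) ^ (N + 1) * x⌋ / 2 := by
  have h := Int.floor_div_natCast ((2 : ℝ) ^ (N + 1) * x) 2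
  rw [show (2 : ℝ) ^ (N + 1) * x / (2 : ℕ) = 2 ^ N * x by push_cast; ring] at h
  exact_mod_cast h

theorem floor_two_pow_eq_of_le {M N : ℕ} (h : M ≤ N) {x y : ℝ}
    (hxy : ⌊(2 : ℝ) ^ N * x⌋ = ⌊(2 : ℝ) ^ N * y⌋) : ⌊(2 : ℝ) ^ M * x⌋ = ⌊(2 : ℝ) ^ M * y⌋ := by
  have key : ∀ z : ℝ, ⌊(2 : ℝ) ^ M * z⌋ = ⌊(2 : ℝ) ^ N * z⌋ / ((2 ^ (N - M) : ℕ) : ℤ) := by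
    intro z
    rw [← Int.floor_div_natCast]
    congr 1
    obtain ⟨d, rfl⟩ := Nat.exists_eq_add_of_le h
    push_cast
    rw [Nat.add_sub_cancel_left, pow_add]
    field_simp
  rw [key, key, hxy]

theorem DyadicConst.mono {α : Type*} {M N : ℕ} (h : M ≤ N) {F : ℝ → α} (hF : DyadicConst M F) :
    DyadicConst N F := fun x y hxy => hF x y (floor_two_pow_eq_of_le h hxy)

theorem DyadicConst.measurable {α : Type*} [MeasurableSpace α] {N : ℕ} {F : ℝ → α}
    (hF : DyadicConst N F) : Measurable F := by
  have : F = (fun k : ℤ => F (k / 2 ^ N)) ∘ fun x => ⌊(2 : ℝ) ^ N * x⌋ := by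
    ext x
    refine hF _ _ ?_
    rw [mul_div_cancel₀ _ (by positivity), Int.floor_intCast]
  rw [this]
  exact (measurable_from_top).comp (Int.measurable_floor.comp (measurable_const_mul _))

theorem dyadicConst_rademacher (N : ℕ) : DyadicConst (N + 1) (rademacher N) := by
  intro x y h
  simp only [rademacher, h]

theorem DyadicConst.mul {N : ℕ} {F G : ℝ → ℝ} (hF : DyadicConst N F) (hG : DyadicConst N G) :
    DyadicConst N (fun x => F x * G x) := fun x y h => by
  simp only [hF x y h, hG x y h]

theorem measurable_deleteDigit (N : ℕ) : Measurable (deleteDigit N) := by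
  unfold deleteDigit
  have h : ∀ M : ℕ, Measurable fun x : ℝ => ((⌊(2 : ℝ) ^ M * x⌋ : ℤ) : ℝ) := fun M =>
    (measurable_from_top (f := fun k : ℤ => (k : ℝ))).comp
      (Int.measurable_floor.comp (measurable_const_mul _))
  exact (measurable_const_mul _).add (((h N).sub (h (N + 1))).div_const _)

/-- Deleting digit `N` does not affect the digits before it. -/
theorem floor_deleteDigit (N : ℕ) (x : ℝ) :
    ⌊(2 : ℝ) ^ N * deleteDigit N x⌋ = ⌊(2 : ℝ) ^ N * x⌋ := by
  have h : (2 : ℝ) ^ N * deleteDigit N x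
      = (⌊(2 : ℝ) ^ N * x⌋ : ℝ) + Int.fract ((2 : ℝ) ^ (N + 1) * x) := by
    rw [deleteDigit, Int.fract, mul_add, mul_div_cancel₀ _ (by positivity)]
    ring
  rw [h, Int.floor_intCast_add, Int.floor_fract, add_zero]

theorem DyadicConst.comp_deleteDigit_eq {α : Type*} {M N : ℕ} (h : M ≤ N) {F : ℝ → α}
    (hF : DyadicConst M F) : F ∘ deleteDigit N = F :=
  funext fun x => hF.mono h _ _ (floor_deleteDigit N x)

/-- Deleting one digit raises the dyadic level by at most one. -/
theorem DyadicConst.comp_deleteDigit {α : Type*} {M : ℕ} (N : ℕ) {F : ℝ → α}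
    (hF : DyadicConst M F) : DyadicConst (M + 1) (F ∘ deleteDigit N) := by
  rcases le_total M N with h | h
  · rw [hF.comp_deleteDigit_eq h]
    exact hF.mono M.le_succ
  · intro x y hxy
    refine hF _ _ ?_
    obtain ⟨d, rfl⟩ := Nat.exists_eq_add_of_le h
    have key : ∀ z : ℝ, ⌊(2 : ℝ) ^ (N + d) * deleteDigit N z⌋
        = ⌊(2 : ℝ) ^ (N + d + 1) * z⌋
          + 2 ^ d * (⌊(2 : ℝ) ^ N * z⌋ - ⌊(2 : ℝ) ^ (N + 1) * z⌋) := by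
      intro z
      rw [← Int.floor_add_intCast]
      congr 1
      rw [deleteDigit]
      push_cast
      rw [pow_add 2 N d]
      field_simp
      ring
    rw [key, key, hxy, floor_two_pow_eq_of_le (show N ≤ N + d + 1 by omega) hxy,
      floor_two_pow_eq_of_le (show N + 1 ≤ N + d + 1 by omega) hxy]

theorem lintegral_two_mul_sub (c : ℝ) {H : ℝ → ℝ≥0∞} (hH : Measurable H) :
    ∫⁻ x, H (2 * x - c) = 2⁻¹ * ∫⁻ x, H x := by
  have h1 : ∫⁻ x, H (2 * x - c) = ∫⁻ y, H (y - c) ∂(Measure.map (fun x : ℝ => 2 * x) volume) := by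
    have h0 : Measurable fun y => H (y - c) := hH.comp (measurable_id.sub_const c)
    rw [lintegral_map h0 (measurable_const_mul _)]
  rw [h1, Real.map_volume_mul_left two_ne_zero, lintegral_smul_measure,
    lintegral_sub_right_eq_self H c, smul_eq_mul]
  congr 1
  rw [abs_of_pos (by norm_num), ENNReal.ofReal_inv_of_pos (by norm_num)]
  norm_num

theorem iUnion_Ico_dyadic (N : ℕ) :
    (⋃ k : ℤ, Set.Ico ((k : ℝ) / 2 ^ N) ((k + 1) / 2 ^ N)) = Set.univ := by
  refine Set.eq_univ_of_forall fun x => Set.mem_iUnion.mpr ⟨⌊(2 : ℝ) ^ N * x⌋, ?_⟩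
  have h2 : (0 : ℝ) < 2 ^ N := by positivity
  constructor
  · rw [div_le_iff₀ h2, mul_comm]; exact Int.floor_le _
  · rw [lt_div_iff₀ h2, mul_comm]; exact Int.lt_floor_add_one _

theorem mem_Ico_dyadic_iff {N : ℕ} {k : ℤ} {x : ℝ} :
    x ∈ Set.Ico ((k : ℝ) / 2 ^ N) ((k + 1) / 2 ^ N) ↔ ⌊(2 : ℝ) ^ N * x⌋ = k := by
  have h2 : (0 : ℝ) < 2 ^ N := by positivity
  rw [Set.mem_Ico, Int.floor_eq_iff, div_le_iff₀ h2, lt_div_iff₀ h2, mul_comm]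

theorem pairwise_disjoint_Ico_dyadic (N : ℕ) :
    Pairwise (Function.onFun Disjoint
      fun k : ℤ => Set.Ico ((k : ℝ) / 2 ^ N) ((k + 1) / 2 ^ N)) := by
  intro k l hkl
  refine Set.disjoint_left.mpr fun x hk hl => hkl ?_
  rw [mem_Ico_dyadic_iff] at hk hl
  exact hk.symm.trans hl

theorem lintegral_eq_tsum_dyadic (N : ℕ) (F : ℝ → ℝ≥0∞) :
    ∫⁻ x, F x = ∑' k : ℤ, ∫⁻ x in Set.Ico ((k : ℝ) / 2 ^ N) ((k + 1) / 2 ^ N), F x := by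
  rw [← lintegral_iUnion (fun _ => measurableSet_Ico) (pairwise_disjoint_Ico_dyadic N),
    iUnion_Ico_dyadic, setLIntegral_univ]

/-- For a random point, the deleted digit is a fair coin independent of the remaining digits. -/
theorem lintegral_deleteDigit (N : ℕ) {F : ℝ → ℝ → ℝ≥0∞} (h1 : Measurable (F 1))
    (h2 : Measurable (F (-1))) :
    ∫⁻ x, F (rademacher N x) (deleteDigit N x) = 2⁻¹ * (∫⁻ y, F 1 y + F (-1) y) := by
  have hN : (0 : ℝ) < 2 ^ N := by positivity
  rw [lintegral_eq_tsum_dyadic N, lintegral_eq_tsum_dyadic N, ← ENNReal.tsum_mul_left]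
  congr 1
  ext k
  set E := Set.Ico ((k : ℝ) / 2 ^ N) ((k + 1) / 2 ^ N) with hE
  have hEm : MeasurableSet E := measurableSet_Ico
  -- on the two halves of `E` the map `deleteDigit N` is `2 x - k / 2 ^ N`, `2 x - (k+1) / 2 ^ N`
  have hpt : ∀ x, E.indicator (fun x => F (rademacher N x) (deleteDigit N x)) x
      = E.indicator (F 1) (2 * x - k / 2 ^ N) + E.indicator (F (-1)) (2 * x - (k + 1) / 2 ^ N) := by
    intro x
    have e1 : 2 * x - k / 2 ^ N ∈ E ↔ ⌊(2 : ℝ) ^ (N + 1) * x⌋ = 2 * k := by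
      rw [hE, mem_Ico_dyadic_iff, show (2 : ℝ) ^ N * (2 * x - k / 2 ^ N)
        = 2 ^ (N + 1) * x - k by field_simp; ring, Int.floor_sub_intCast]
      omega
    have e2 : 2 * x - (k + 1) / 2 ^ N ∈ E ↔ ⌊(2 : ℝ) ^ (N + 1) * x⌋ = 2 * k + 1 := by
      rw [hE, mem_Ico_dyadic_iff, show (2 : ℝ) ^ N * (2 * x - (k + 1) / 2 ^ N)
        = 2 ^ (N + 1) * x - (k + 1 : ℤ) by push_cast; field_simp; ring, Int.floor_sub_intCast]
      omega
    have e3 : x ∈ E ↔ ⌊(2 : ℝ) ^ (N + 1) * x⌋ / 2 = k := by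
      rw [hE, mem_Ico_dyadic_iff, floor_two_pow_eq_ediv_two]
    by_cases hx : x ∈ E
    · have hk := mem_Ico_dyadic_iff.mp hx
      rw [Set.indicator_of_mem hx]
      rcases (show ⌊(2 : ℝ) ^ (N + 1) * x⌋ = 2 * k ∨ ⌊(2 : ℝ) ^ (N + 1) * x⌋ = 2 * k + 1 by
        have := e3.mp hx; omega) with h | h
      · rw [Set.indicator_of_mem (e1.mpr h), Set.indicator_of_notMem, add_zero]
        · have : rademacher N x = 1 := by simp [rademacher, h]
          rw [this, deleteDigit, hk, h]
          congr 1; push_cast; ring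
        · rw [e2]; omega
      · rw [Set.indicator_of_mem (e2.mpr h), Set.indicator_of_notMem, zero_add]
        · have : rademacher N x = -1 := by simp [rademacher, h]
          rw [this, deleteDigit, hk, h]
          congr 1; push_cast; ring
        · rw [e1]; omega
    · rw [Set.indicator_of_notMem hx, Set.indicator_of_notMem, Set.indicator_of_notMem, add_zero]
      · rw [e2]; rw [e3] at hx; omega
      · rw [e1]; rw [e3] at hx; omega
  rw [← lintegral_indicator hEm]
  simp_rw [hpt]
  have m1 := h1.indicator hEm
  have m2 := h2.indicator hEm
  have m3 : Measurable fun x => E.indicator (F 1) (2 * x - k / 2 ^ N) :=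
    m1.comp ((measurable_const_mul 2).sub_const _)
  rw [lintegral_add_left m3,
    lintegral_two_mul_sub _ m1, lintegral_two_mul_sub _ m2, ← mul_add,
    lintegral_indicator hEm, lintegral_indicator hEm, lintegral_add_left h1]

/-- Delete the digits `N 0, …, N (n - 1)`, the last one first. -/
noncomputable def deleteDigits (N : ℕ → ℕ) : ℕ → ℝ → ℝ
  | 0 => id
  | n + 1 => deleteDigits N n ∘ deleteDigit (N n)

theorem measurable_deleteDigits (N : ℕ → ℕ) (n : ℕ) : Measurable (deleteDigits N n) := by
  induction n with
  | zero => exact measurable_id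
  | succ n ih => exact ih.comp (measurable_deleteDigit _)

theorem floor_deleteDigits (N : ℕ → ℕ) (n : ℕ) (x : ℝ) : ⌊deleteDigits N n x⌋ = ⌊x⌋ := by
  induction n generalizing x with
  | zero => rfl
  | succ n ih =>
    have h : DyadicConst 0 (fun x : ℝ => ⌊x⌋) := fun x y h => by simpa using h
    rw [deleteDigits, Function.comp_apply, ih]
    exact congrFun (h.comp_deleteDigit_eq (Nat.zero_le (N n))) x

theorem DyadicConst.comp_deleteDigits {α : Type*} {k : ℕ} (N : ℕ → ℕ) (n : ℕ) {F : ℝ → α}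
    (hF : DyadicConst k F) : DyadicConst (k + n) (F ∘ deleteDigits N n) := by
  induction n with
  | zero => exact hF
  | succ n ih => exact ih.comp_deleteDigit (N n)

/-- The modulated sequence: `u i`, read off the digits other than `N 0, …, N (i - 1)`, multiplied
by the random sign carried by the digit `N i`. -/
noncomputable def modulate (N : ℕ → ℕ) (u : ℕ → ℝ → ℝ) (i : ℕ) (x : ℝ) : ℝ :=
  u i (deleteDigits N i x) * rademacher (N i) x

theorem dyadicConst_modulate {N k : ℕ → ℕ} {u : ℕ → ℝ → ℝ} {i : ℕ} (hu : DyadicConst (k i) (u i))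
    (hk : k i + i ≤ N i) : DyadicConst (N i + 1) (modulate N u i) :=
  ((hu.comp_deleteDigits N i).mono (hk.trans (N i).le_succ)).mul (dyadicConst_rademacher (N i))

/-- The modulated sequence has, on every union `J` of unit intervals, the joint distribution of
the sequence `u` with independent random signs. The function `w` is carried along for the
induction. -/
theorem lintegral_modulate {N k : ℕ → ℕ} (hN : StrictMono N) {u : ℕ → ℝ → ℝ}
    (hu : ∀ i, DyadicConst (k i) (u i)) (hk : ∀ i, k i + i ≤ N i) {J : Set ℝ}
    (hJ : DyadicConst 0 (· ∈ J)) {φ : ℝ → ℝ≥0∞} (hφ : Measurable φ) (a : ℕ → ℝ) (n : ℕ)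
    {w : ℝ → ℝ} (hw : Measurable w) :
    ∫⁻ x in J, φ (w (deleteDigits N n x) + ∑ i ∈ Finset.range n, a i * modulate N u i x)
      = (2 ^ n)⁻¹ * ∑ t ∈ (Finset.range n).powerset,
          ∫⁻ x in J, φ (w x + ∑ i ∈ Finset.range n, a i * signOf t i * u i x) := by
  have hJm : MeasurableSet J := measurableSet_setOfPred.mpr hJ.measurable
  have hum : ∀ i, Measurable (u i) := fun i => (hu i).measurable
  have hgm : ∀ i, Measurable (modulate N u i) := fun i =>
    (dyadicConst_modulate (hu i) (hk i)).measurable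
  induction n generalizing w with
  | zero => simp [deleteDigits]
  | succ n ih =>
    let F : ℝ → ℝ → ℝ≥0∞ := fun ε y => J.indicator (fun y => φ (w (deleteDigits N n y)
      + a n * ε * u n (deleteDigits N n y) + ∑ i ∈ Finset.range n, a i * modulate N u i y)) y
    have hF : ∀ ε, Measurable (F ε) := fun ε => by
      refine Measurable.indicator (hφ.comp ?_) hJm
      have h1 := hw.comp (measurable_deleteDigits N n)
      have h2 := (hum n).comp (measurable_deleteDigits N n)
      exact (h1.add (h2.const_mul _)).add
        (Finset.measurable_fun_sum _ fun i _ => (hgm i).const_mul _)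
    -- all but the last of the signs, and all the values of `u`, only see `deleteDigit (N n) x`
    have hL : ∫⁻ x in J, φ (w (deleteDigits N (n + 1) x)
          + ∑ i ∈ Finset.range (n + 1), a i * modulate N u i x)
        = ∫⁻ x, F (rademacher (N n) x) (deleteDigit (N n) x) := by
      rw [← lintegral_indicator hJm]
      congr 1
      ext x
      have e1 : deleteDigit (N n) x ∈ J ↔ x ∈ J :=
        (congrFun (hJ.comp_deleteDigit_eq (Nat.zero_le (N n))) x).to_iff
      have e2 : ∑ i ∈ Finset.range n, a i * modulate N u i (deleteDigit (N n) x)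
          = ∑ i ∈ Finset.range n, a i * modulate N u i x :=
        Finset.sum_congr rfl fun i hi => congrArg (a i * ·) <|
          congrFun ((dyadicConst_modulate (hu i) (hk i)).comp_deleteDigit_eq
            (hN (Finset.mem_range.mp hi))) x
      have e3 : u n (deleteDigits N n (deleteDigit (N n) x)) = u n (deleteDigits N n x) :=
        congrFun (((hu n).comp_deleteDigits N n).comp_deleteDigit_eq (hk n)) x
      simp only [F]
      by_cases hx : x ∈ J
      · rw [Set.indicator_of_mem hx, Set.indicator_of_mem (e1.mpr hx), Finset.sum_range_succ,
          e2, e3]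
        simp only [modulate, deleteDigits, Function.comp_apply]
        congr 1
        ring
      · rw [Set.indicator_of_notMem hx, Set.indicator_of_notMem (mt e1.mp hx)]
    have hI : ∀ ε : ℝ, ∫⁻ y, F ε y = (2 ^ n)⁻¹ * ∑ t ∈ (Finset.range n).powerset,
          ∫⁻ x in J, φ (w x + a n * ε * u n x
            + ∑ i ∈ Finset.range n, a i * signOf t i * u i x) := fun ε => by
      have h := ih (w := fun x => w x + a n * ε * u n x) (hw.add ((hum n).const_mul (a n * ε)))
      rw [← h, ← lintegral_indicator hJm]
    have hsum : ∀ t ∈ (Finset.range n).powerset, ∀ x,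
        (w x + a n * 1 * u n x + ∑ i ∈ Finset.range n, a i * signOf t i * u i x
          = w x + ∑ i ∈ Finset.range (n + 1), a i * signOf (insert n t) i * u i x) ∧
        (w x + a n * (-1) * u n x + ∑ i ∈ Finset.range n, a i * signOf t i * u i x
          = w x + ∑ i ∈ Finset.range (n + 1), a i * signOf t i * u i x) := by
      intro t ht x
      have hnt : n ∉ t := fun h => by simpa using Finset.mem_powerset.mp ht h
      have hc : ∑ i ∈ Finset.range n, a i * signOf (insert n t) i * u i x
          = ∑ i ∈ Finset.range n, a i * signOf t i * u i x := by
        refine Finset.sum_congr rfl fun i hi => ?_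
        have : i ≠ n := (Finset.mem_range.mp hi).ne
        simp [signOf, this]
      rw [Finset.sum_range_succ, Finset.sum_range_succ, hc]
      constructor
      · simp only [signOf, Finset.mem_insert_self, if_true]; ring
      · simp only [signOf, hnt, if_false]; ring
    rw [hL, lintegral_deleteDigit (N n) (hF 1) (hF (-1)), lintegral_add_left (hF 1), hI, hI,
      ← mul_add, ← mul_assoc, Finset.range_add_one, Finset.sum_powerset_insert (by simp),
      ← Finset.range_add_one, add_comm]
    congr 1
    · rw [pow_succ, ENNReal.mul_inv (by simp) (by simp), mul_comm]
    · congr 1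
      · exact Finset.sum_congr rfl fun t ht => by simp only [(hsum t ht _).2]
      · exact Finset.sum_congr rfl fun t ht => by simp only [(hsum t ht _).1]

end Dyadic

/-! ### Random signs -/

section RandomSigns

/-- Adding one index to a random signed sum amounts to averaging over one more fair sign. -/
theorem sum_powerset_insert_signOf {s : Finset ℕ} {j : ℕ} (hj : j ∉ s) (c : ℕ → ℝ) (ψ : ℝ → ℝ) :
    ∑ t ∈ (insert j s).powerset, ψ (∑ i ∈ insert j s, c i * signOf t i)
      = ∑ t ∈ s.powerset, (ψ (∑ i ∈ s, c i * signOf t i - c j)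
          + ψ (∑ i ∈ s, c i * signOf t i + c j)) := by
  rw [Finset.sum_powerset_insert hj, ← Finset.sum_add_distrib]
  refine Finset.sum_congr rfl fun t ht => ?_
  have hjt : j ∉ t := fun h => hj (Finset.mem_powerset.mp ht h)
  rw [Finset.sum_insert hj, Finset.sum_insert hj]
  have hc : ∑ i ∈ s, c i * signOf (insert j t) i = ∑ i ∈ s, c i * signOf t i := by
    refine Finset.sum_congr rfl fun i hi => ?_
    have : i ≠ j := fun h => hj (h ▸ hi)
    simp [signOf, this]
  rw [hc]
  congr 2
  · simp only [signOf, hjt, if_false]; ring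
  · simp only [signOf, Finset.mem_insert_self, if_true]; ring

theorem sum_powerset_signOf_sq (s : Finset ℕ) (c : ℕ → ℝ) :
    ∑ t ∈ s.powerset, (∑ i ∈ s, c i * signOf t i) ^ 2 = 2 ^ s.card * ∑ i ∈ s, c i ^ 2 := by
  induction s using Finset.induction_on with
  | empty => simp
  | insert j s hj ih =>
    have h : ∀ x : ℝ, (x - c j) ^ 2 + (x + c j) ^ 2 = 2 * x ^ 2 + 2 * c j ^ 2 := fun x => by ring
    rw [sum_powerset_insert_signOf hj c (· ^ 2)]
    simp only [h]
    rw [Finset.sum_add_distrib, ← Finset.mul_sum, ih, Finset.sum_const, Finset.card_powerset,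
      Finset.card_insert_of_notMem hj, Finset.sum_insert hj, nsmul_eq_mul, pow_succ]
    push_cast
    ring

theorem sum_powerset_signOf_pow_four_le (s : Finset ℕ) (c : ℕ → ℝ) :
    ∑ t ∈ s.powerset, (∑ i ∈ s, c i * signOf t i) ^ 4
      ≤ 2 ^ s.card * (3 * (∑ i ∈ s, c i ^ 2) ^ 2) := by
  induction s using Finset.induction_on with
  | empty => simp
  | insert j s hj ih =>
    have h : ∀ x : ℝ, (x - c j) ^ 4 + (x + c j) ^ 4
        = 2 * x ^ 4 + 12 * c j ^ 2 * x ^ 2 + 2 * c j ^ 4 := fun x => by ring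
    rw [sum_powerset_insert_signOf hj c (· ^ 4)]
    simp only [h]
    rw [Finset.sum_add_distrib, Finset.sum_add_distrib, ← Finset.mul_sum, ← Finset.mul_sum,
      sum_powerset_signOf_sq, Finset.sum_const, Finset.card_powerset,
      Finset.card_insert_of_notMem hj, Finset.sum_insert hj, nsmul_eq_mul, pow_succ (2 : ℝ)]
    push_cast
    have h4 : (0 : ℝ) ≤ 2 ^ s.card * c j ^ 4 := by positivity
    nlinarith

/-- The upper Khintchine inequality for exponents at most four. -/
theorem sum_powerset_signOf_rpow_le {q : ℝ} (hq : 0 < q) (hq4 : q ≤ 4) (s : Finset ℕ)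
    (c : ℕ → ℝ) :
    ∑ t ∈ s.powerset, |∑ i ∈ s, c i * signOf t i| ^ q
      ≤ 2 ^ s.card * (3 * (∑ i ∈ s, c i ^ 2) ^ (q / 2)) := by
  set A := ∑ i ∈ s, c i ^ 2 with hA
  have hA0 : 0 ≤ A := Finset.sum_nonneg fun i _ => sq_nonneg _
  have h2 : (0 : ℝ) < 2 ^ s.card := by positivity
  have hJ := Real.arith_mean_le_rpow_mean s.powerset (fun _ => ((2 : ℝ) ^ s.card)⁻¹)
    (fun t => |∑ i ∈ s, c i * signOf t i| ^ q) (fun _ _ => by positivity)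
    (by rw [Finset.sum_const, Finset.card_powerset, nsmul_eq_mul]; push_cast
        exact mul_inv_cancel₀ h2.ne')
    (fun _ _ => by positivity) (p := 4 / q) (by rw [le_div_iff₀ hq]; linarith)
  have h4 : ∀ x : ℝ, (|x| ^ q) ^ (4 / q) = x ^ 4 := fun x => by
    rw [← Real.rpow_mul (abs_nonneg x), mul_div_cancel₀ _ hq.ne']
    rw [show (4 : ℝ) = ((4 : ℕ) : ℝ) by norm_num, Real.rpow_natCast]
    exact Even.pow_abs (by decide) x
  simp only [h4, ← Finset.mul_sum] at hJ
  rw [inv_mul_le_iff₀ h2] at hJ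
  refine hJ.trans ?_
  gcongr
  have h5 : (2 ^ s.card)⁻¹ * ∑ t ∈ s.powerset, (∑ i ∈ s, c i * signOf t i) ^ 4 ≤ 3 * A ^ 2 := by
    rw [inv_mul_le_iff₀ h2]
    exact sum_powerset_signOf_pow_four_le s c
  have hr : 1 / (4 / q) = q / 4 := by rw [one_div_div]
  rw [hr]
  calc _ ≤ (3 * A ^ 2) ^ (q / 4) := by
        refine Real.rpow_le_rpow ?_ h5 (by positivity)
        exact mul_nonneg (by positivity) (Finset.sum_nonneg fun _ _ => by positivity)
    _ = 3 ^ (q / 4) * A ^ (q / 2) := by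
        rw [Real.mul_rpow (by norm_num) (by positivity), ← Real.rpow_natCast A 2,
          ← Real.rpow_mul hA0]
        congr 2; push_cast; ring
    _ ≤ 3 ^ (1 : ℝ) * A ^ (q / 2) := by
        gcongr
        · norm_num
        · linarith
    _ = _ := by rw [Real.rpow_one]

/-- A two-point inequality: convexity of `y ↦ y ^ (q / 2)` on the squares `(x ± c) ^ 2`, whose mean
is `x ^ 2 + c ^ 2`, and superadditivity of the same power. -/
theorem two_mul_rpow_add_le {q : ℝ} (hq : 2 ≤ q) (x c : ℝ) :
    2 * (|x| ^ q + |c| ^ q) ≤ |x - c| ^ q + |x + c| ^ q := by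
  have h : ∀ y : ℝ, |y| ^ q = (y ^ 2) ^ (q / 2) := fun y => by
    rw [← sq_abs, ← Real.rpow_natCast, ← Real.rpow_mul (abs_nonneg y)]
    congr 1; push_cast; ring
  have hq1 : 1 ≤ q / 2 := by linarith
  simp only [h]
  have h1 := Real.add_rpow_le_rpow_add (sq_nonneg x) (sq_nonneg c) hq1
  have h2 := (convexOn_rpow hq1).2 (sq_nonneg (x - c) : (x - c) ^ 2 ∈ Set.Ici 0)
    (sq_nonneg (x + c) : (x + c) ^ 2 ∈ Set.Ici 0) (by norm_num : (0 : ℝ) ≤ 1 / 2)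
    (by norm_num : (0 : ℝ) ≤ 1 / 2) (by norm_num)
  simp only [smul_eq_mul] at h2
  rw [show 1 / 2 * (x - c) ^ 2 + 1 / 2 * (x + c) ^ 2 = x ^ 2 + c ^ 2 by ring] at h2
  linarith

/-- For exponents at least two, random signed sums dominate the `ℓ_q` norm of the coefficients. -/
theorem sum_rpow_le_sum_powerset_signOf {q : ℝ} (hq : 2 ≤ q) (s : Finset ℕ) (c : ℕ → ℝ) :
    2 ^ s.card * ∑ i ∈ s, |c i| ^ q ≤ ∑ t ∈ s.powerset, |∑ i ∈ s, c i * signOf t i| ^ q := by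
  induction s using Finset.induction_on with
  | empty => simp [Real.zero_rpow (by linarith : q ≠ 0)]
  | insert j s hj ih =>
    rw [sum_powerset_insert_signOf hj c (fun x => |x| ^ q)]
    refine le_trans ?_ (Finset.sum_le_sum fun t _ => two_mul_rpow_add_le hq _ (c j))
    rw [← Finset.mul_sum, Finset.sum_add_distrib, Finset.sum_const, Finset.card_powerset,
      Finset.card_insert_of_notMem hj, Finset.sum_insert hj, nsmul_eq_mul, pow_succ]
    push_cast
    nlinarith

end RandomSigns

/-! ### Dyadic step functions and the Haar system -/

section StepFunctions

theorem floor_mem_Ico_iff {R : ℕ} {x : ℝ} :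
    ⌊x⌋ ∈ Finset.Ico (-R : ℤ) R ↔ x ∈ Set.Ico (-R : ℝ) R := by
  rw [Finset.mem_Ico, Set.mem_Ico, Int.le_floor, Int.floor_lt]
  push_cast
  rfl

theorem floor_two_pow_mul_ediv (N : ℕ) (x : ℝ) : ⌊(2 : ℝ) ^ N * x⌋ / 2 ^ N = ⌊x⌋ := by
  have h := Int.floor_div_natCast ((2 : ℝ) ^ N * x) (2 ^ N)
  push_cast at h
  rw [← h, mul_div_cancel_left₀ _ (by positivity)]

/-- A dyadic step function vanishing off a bounded interval lies in every `L_p`. -/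
theorem DyadicConst.memLp {N R : ℕ} {v : ℝ → ℝ} (hv : DyadicConst N v)
    (hR : ∀ x, ⌊x⌋ ∉ Finset.Ico (-R : ℤ) R → v x = 0) (p : ℝ≥0∞) :
    MemLp v p (volume : Measure ℝ) := by
  have h : v = ∑ k ∈ Finset.Ico (-R * 2 ^ N : ℤ) (R * 2 ^ N),
      (Set.Ico ((k : ℝ) / 2 ^ N) ((k + 1) / 2 ^ N)).indicator fun _ => v (k / 2 ^ N) := by
    ext x
    rw [Finset.sum_apply]
    simp only [Set.indicator_apply, mem_Ico_dyadic_iff]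
    rw [Finset.sum_ite_eq]
    have h2 : (0 : ℤ) < 2 ^ N := by positivity
    have hiff : ⌊(2 : ℝ) ^ N * x⌋ ∈ Finset.Ico (-R * 2 ^ N : ℤ) (R * 2 ^ N)
        ↔ ⌊x⌋ ∈ Finset.Ico (-R : ℤ) R := by
      rw [← floor_two_pow_mul_ediv N x, Finset.mem_Ico, Finset.mem_Ico,
        Int.le_ediv_iff_mul_le h2, Int.ediv_lt_iff_lt_mul h2]
    split_ifs with hx
    · refine hv _ _ ?_
      rw [mul_div_cancel₀ _ (by positivity), Int.floor_intCast]
    · exact hR x (mt hiff.mpr hx)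
  rw [h]
  exact memLp_finsetSum' _ fun k _ =>
    memLp_indicator_const p measurableSet_Ico _ (Or.inr measure_Ico_lt_top.ne)

/-- Boundedly supported dyadic step functions are dense in `L_p`. -/
theorem exists_dyadicConst_norm_sub_le {p : ℝ≥0∞} [Fact (1 ≤ p)] (hp : p ≠ ∞)
    (f : Lp ℝ p (volume : Measure ℝ)) {ε : ℝ} (hε : 0 < ε) :
    ∃ (u : ℝ → ℝ) (k R : ℕ) (hu : MemLp u p volume), DyadicConst k u ∧
      (∀ x, ⌊x⌋ ∉ Finset.Ico (-R : ℤ) R → u x = 0) ∧ ‖f - hu.toLp u‖ ≤ ε := by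
  have hε2 : 0 < ε / 2 := by positivity
  obtain ⟨φ, hφs, hφc, hφ, hφp⟩ := (Lp.memLp f).exists_hasCompactSupport_eLpNorm_sub_le hp
    (ε := ENNReal.ofReal (ε / 2)) (by simpa using hε2)
  obtain ⟨r, hr⟩ := hφs.isCompact.isBounded.subset_closedBall 0
  obtain ⟨R, hR⟩ := exists_nat_gt r
  have hφ0 : ∀ x, ⌊x⌋ ∉ Finset.Ico (-R : ℤ) R → φ x = 0 := by
    intro x hx
    by_contra h
    have hx' := hr (subset_tsupport φ h)
    rw [mem_closedBall_zero_iff, Real.norm_eq_abs, abs_le] at hx'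
    exact hx (floor_mem_Ico_iff.mpr ⟨by linarith, by linarith⟩)
  -- `η` is chosen so that a uniform error `η` on `[-R, R)` has `L_p` norm at most `ε / 2`
  set V : ℝ := (2 * R) ^ (1 / p.toReal) with hV
  have hV0 : 0 ≤ V := by positivity
  set η := ε / 2 / (V + 1) with hη
  have hη0 : 0 < η := by positivity
  obtain ⟨δ, hδ, hδφ⟩ := Metric.uniformContinuous_iff.mp
    (hφs.uniformContinuous_of_continuous hφ) η hη0
  obtain ⟨k, hk⟩ := exists_pow_lt_of_lt_one hδ (by norm_num : (1 / 2 : ℝ) < 1)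
  set u : ℝ → ℝ := fun x =>
    if ⌊x⌋ ∈ Finset.Ico (-R : ℤ) R then φ (⌊(2 : ℝ) ^ k * x⌋ / 2 ^ k) else 0 with hu
  have huk : DyadicConst k u := by
    intro x y h
    have h0 := floor_two_pow_eq_of_le (Nat.zero_le k) h
    simp only [pow_zero, one_mul] at h0
    simp only [hu, h, h0]
  have hu0 : ∀ x, ⌊x⌋ ∉ Finset.Ico (-R : ℤ) R → u x = 0 := fun x hx => if_neg hx
  have hum := huk.memLp hu0 p
  refine ⟨u, k, R, hum, huk, hu0, ?_⟩
  have hclose : ∀ x, ‖(φ - u) x‖ ≤ ‖(Set.Ico (-R : ℝ) R).indicator (fun _ => η) x‖ := by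
    intro x
    by_cases hx : ⌊x⌋ ∈ Finset.Ico (-R : ℤ) R
    · rw [Set.indicator_of_mem (floor_mem_Ico_iff.mp hx), Pi.sub_apply]
      have h2 : (0 : ℝ) < 2 ^ k := by positivity
      have hd : dist x (⌊(2 : ℝ) ^ k * x⌋ / 2 ^ k) < δ := by
        refine lt_trans ?_ hk
        have e : x - ⌊(2 : ℝ) ^ k * x⌋ / 2 ^ k = Int.fract ((2 : ℝ) ^ k * x) / 2 ^ k := by
          rw [Int.fract]; field_simp
        rw [Real.dist_eq, e, abs_of_nonneg (div_nonneg (Int.fract_nonneg _) h2.le), one_div,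
          inv_pow, ← one_div]
        exact div_lt_div_of_pos_right (Int.fract_lt_one _) h2
      have := hδφ hd
      rw [dist_eq_norm] at this
      simp only [hu, if_pos hx]
      rw [Real.norm_of_nonneg hη0.le]
      exact this.le
    · rw [Pi.sub_apply, hu0 x hx, hφ0 x hx]; simp
  have h1 : eLpNorm (φ - u) p volume ≤ ENNReal.ofReal (ε / 2) := by
    refine (eLpNorm_mono hclose).trans ((eLpNorm_indicator_const_le _ _).trans ?_)
    rw [Real.volume_Ico, Real.enorm_of_nonneg hη0.le,
      ENNReal.ofReal_rpow_of_nonneg (by linarith [R.cast_nonneg (α := ℝ)]) (by positivity),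
      ← ENNReal.ofReal_mul hη0.le]
    refine ENNReal.ofReal_le_ofReal ?_
    rw [show (R : ℝ) - -R = 2 * R by ring, ← hV, hη, div_mul_eq_mul_div,
      div_le_iff₀ (by positivity)]
    nlinarith
  have h2 : eLpNorm (⇑f - u) p volume ≤ ENNReal.ofReal ε := by
    have : (⇑f - u : ℝ → ℝ) = (⇑f - φ) + (φ - u) := by simp
    rw [this]
    refine (eLpNorm_add_le ((Lp.aestronglyMeasurable f).sub hφp.1) (hφp.1.sub hum.1)
      Fact.out).trans ((add_le_add hφc h1).trans ?_)
    rw [← ENNReal.ofReal_add hε2.le hε2.le, add_halves]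
  have h3 : f - hum.toLp u = ((Lp.memLp f).sub hum).toLp (⇑f - u) := by
    rw [MemLp.toLp_sub (Lp.memLp f) hum, Lp.toLp_coeFn]
  rw [h3, Lp.norm_toLp]
  exact ENNReal.toReal_le_of_le_ofReal hε.le h2

/-- The Haar functions of level `N` are multiples of the restrictions of `rademacher N` to the
dyadic intervals of length `2⁻ᴺ`. -/
theorem haarLp_coeFn (p : ℝ≥0∞) (m : ℤ) {N j : ℕ} (hj : j ∈ Finset.Ico (2 ^ N) (2 ^ (N + 1))) :
    haarLp p m j =ᵐ[volume] fun x => (2 : ℝ) ^ ((N : ℝ) / p.toReal) *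
      if ⌊(2 : ℝ) ^ N * x⌋ = m * 2 ^ N + (j - 2 ^ N) then rademacher N x else 0 := by
  rw [Finset.mem_Ico] at hj
  have hlog : Nat.log 2 j = N := Nat.log_eq_of_pow_le_of_lt_pow hj.1 hj.2
  have hj0 : j ≠ 0 := (lt_of_lt_of_le (by positivity) hj.1).ne'
  set c : ℝ := (2 : ℝ) ^ ((N : ℝ) / p.toReal)
  set K : ℤ := m * 2 ^ N + (j - 2 ^ N) with hK
  have h2 : (0 : ℝ) < 2 ^ N := by positivity
  -- the Haar function lives on the two children, numbered `2 K` and `2 K + 1`, of interval `K`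
  have hdef : haarLp p m j = stepLp p ((2 * K : ℤ) / 2 ^ (N + 1)) (((2 * K : ℤ) + 1) / 2 ^ (N + 1)) c
      - stepLp p ((2 * K + 1 : ℤ) / 2 ^ (N + 1)) (((2 * K + 1 : ℤ) + 1) / 2 ^ (N + 1)) c := by
    rw [haarLp, if_neg hj0]
    simp only [hlog]
    congr 1
    · congr 1
      · rw [hK]; push_cast; field_simp; ring
      · rw [hK]; push_cast; field_simp; ring
    · congr 1
      · rw [hK]; push_cast; field_simp; ring
      · rw [hK]; push_cast; field_simp; ring
  rw [hdef]
  filter_upwards [Lp.coeFn_sub (stepLp p ((2 * K : ℤ) / 2 ^ (N + 1))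
      (((2 * K : ℤ) + 1) / 2 ^ (N + 1)) c) (stepLp p ((2 * K + 1 : ℤ) / 2 ^ (N + 1))
      (((2 * K + 1 : ℤ) + 1) / 2 ^ (N + 1)) c),
    indicatorConstLp_coeFn (p := p) (hs := (measurableSet_Ico :
      MeasurableSet (Set.Ico (((2 * K : ℤ) : ℝ) / 2 ^ (N + 1)) (((2 * K : ℤ) + 1) / 2 ^ (N + 1)))))
      (hμs := (measure_Ico_lt_top (μ := (volume : Measure ℝ))).ne) (c := c),
    indicatorConstLp_coeFn (p := p) (hs := (measurableSet_Ico :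
      MeasurableSet (Set.Ico (((2 * K + 1 : ℤ) : ℝ) / 2 ^ (N + 1))
        (((2 * K + 1 : ℤ) + 1) / 2 ^ (N + 1)))))
      (hμs := (measure_Ico_lt_top (μ := (volume : Measure ℝ))).ne) (c := c)] with x h0 h1 h3
  rw [h0, Pi.sub_apply]
  unfold stepLp
  rw [h1, h3]
  simp only [Set.indicator_apply, mem_Ico_dyadic_iff]
  rw [floor_two_pow_eq_ediv_two N x]
  generalize hF : ⌊(2 : ℝ) ^ (N + 1) * x⌋ = F
  by_cases hFK : F / 2 = K
  · rcases (show F = 2 * K ∨ F = 2 * K + 1 by omega) with h | h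
    · simp [rademacher, hF, h]
    · have : (2 * K + 1) / 2 = K := by omega
      simp [rademacher, hF, h, this]
  · have e1 : F ≠ 2 * K := by omega
    have e2 : F ≠ 2 * K + 1 := by omega
    simp [e1, e2, hFK]

/-- The Haar coefficients, at level `N`, of the product of `v` with `rademacher N`. -/
noncomputable def haarCoeff (p : ℝ≥0∞) (N : ℕ) (v : ℝ → ℝ) (z : ℤ × ℕ) : ℝ :=
  v (z.1 + ((z.2 : ℝ) - 2 ^ N) / 2 ^ N) / (2 : ℝ) ^ ((N : ℝ) / p.toReal)

/-- A step function of level `N` times `rademacher N` is a combination of Haar functions of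
level `N`. -/
theorem sum_haarCoeff_smul_haarLp_coeFn (p : ℝ≥0∞) {N R : ℕ} {v : ℝ → ℝ} (hv : DyadicConst N v)
    (hR : ∀ x, ⌊x⌋ ∉ Finset.Ico (-R : ℤ) R → v x = 0) :
    (∑ z ∈ Finset.Ico (-R : ℤ) R ×ˢ Finset.Ico (2 ^ N) (2 ^ (N + 1)),
      haarCoeff p N v z • haarLp p z.1 z.2 : Lp ℝ p (volume : Measure ℝ))
      =ᵐ[volume] fun x => v x * rademacher N x := by
  set P := Finset.Ico (-R : ℤ) R ×ˢ Finset.Ico (2 ^ N) (2 ^ (N + 1)) with hP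
  have h1 : ∀ z ∈ P, ((haarCoeff p N v z • haarLp p z.1 z.2 : Lp ℝ p volume) : ℝ → ℝ)
      =ᵐ[volume] fun x => if ⌊(2 : ℝ) ^ N * x⌋ = z.1 * 2 ^ N + (z.2 - 2 ^ N)
        then v x * rademacher N x else 0 := by
    intro z hz
    filter_upwards [Lp.coeFn_smul (haarCoeff p N v z) (haarLp p z.1 z.2),
      haarLp_coeFn p z.1 (Finset.mem_product.mp hz).2] with x hx1 hx2
    rw [hx1, Pi.smul_apply, hx2, smul_eq_mul]
    split_ifs with h
    · have hvx : v (z.1 + ((z.2 : ℝ) - 2 ^ N) / 2 ^ N) = v x := by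
        refine hv _ _ ?_
        rw [h, mul_add, mul_div_cancel₀ _ (by positivity),
          show (2 : ℝ) ^ N * z.1 + ((z.2 : ℝ) - 2 ^ N)
            = ((z.1 * 2 ^ N + (z.2 - 2 ^ N) : ℤ) : ℝ) by push_cast; ring, Int.floor_intCast]
      rw [haarCoeff, hvx, ← mul_assoc, div_mul_cancel₀]
      positivity
    · simp
  have h2 := (ae_ball_iff P.countable_toSet).mpr h1
  filter_upwards [h2, Lp.coeFn_finsetSum P fun z => haarCoeff p N v z • haarLp p z.1 z.2]
    with x hx1 hx2
  rw [hx2, Finset.sum_apply, Finset.sum_congr rfl fun z hz => hx1 z hz]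
  by_cases hx : ⌊x⌋ ∈ Finset.Ico (-R : ℤ) R
  · have hpos : (0 : ℤ) < 2 ^ N := by positivity
    set F := ⌊(2 : ℝ) ^ N * x⌋ with hF
    have hdiv : F / 2 ^ N = ⌊x⌋ := floor_two_pow_mul_ediv N x
    have hm0 := Int.emod_nonneg F hpos.ne'
    have hm1 := Int.emod_lt_of_pos F hpos
    have hdm := Int.ediv_mul_add_emod F (2 ^ N)
    have hcast : (((F % 2 ^ N).toNat : ℕ) : ℤ) = F % 2 ^ N := Int.toNat_of_nonneg hm0
    have hlt : (F % 2 ^ N).toNat < 2 ^ N := by zify; rw [hcast]; exact hm1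
    rw [Finset.sum_eq_single (⌊x⌋, 2 ^ N + (F % 2 ^ N).toNat)]
    · rw [if_pos]
      push_cast
      rw [hcast, ← hdiv]
      linarith
    · rintro ⟨m, j⟩ hz hne
      rw [if_neg]
      intro h
      have hj := Finset.mem_Ico.mp (Finset.mem_product.mp hz).2
      obtain ⟨l, rfl⟩ := Nat.exists_eq_add_of_le hj.1
      have hl : l < 2 ^ N := by have := hj.2; simp only [pow_succ] at this; omega
      have hl' : (l : ℤ) < 2 ^ N := by exact_mod_cast hl
      have hFe : F = l + m * 2 ^ N := by rw [h]; push_cast; ring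
      have hm : F / 2 ^ N = m := by
        rw [hFe, Int.add_mul_ediv_right _ _ hpos.ne', Int.ediv_eq_zero_of_lt (by positivity) hl',
          zero_add]
      have hl2 : F % 2 ^ N = l := by
        rw [hFe, Int.add_mul_emod_self_right, Int.emod_eq_of_lt (by positivity) hl']
      refine hne ?_
      rw [hl2, ← hdiv, hm, Int.toNat_natCast]
    · intro h
      refine absurd (Finset.mem_product.mpr ⟨hx, Finset.mem_Ico.mpr ⟨by simp, ?_⟩⟩) h
      simp only [pow_succ]; omega
  · rw [hR x hx]; simp

/-- High levels of the Haar system come late in any enumeration, so that a sequence of levels can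
be chosen whose Haar functions over given bounded ranges occupy successive intervals. -/
theorem exists_levels (e : ℕ ≃ ℤ × ℕ) (k R : ℕ → ℕ) :
    ∃ N n : ℕ → ℕ, StrictMono N ∧ StrictMono n ∧ ∀ i, k i + i ≤ N i ∧
      ∀ z ∈ Finset.Ico (-R i : ℤ) (R i) ×ˢ Finset.Ico (2 ^ N i) (2 ^ (N i + 1)),
        e.symm z ∈ Finset.Ico (n i) (n (i + 1)) := by
  have step : ∀ (i : ℕ) (σ : ℕ × ℕ), ∃ τ : ℕ × ℕ, σ.1 < τ.1 ∧ σ.2 < τ.2 ∧ k i + i ≤ τ.1 ∧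
      ∀ z ∈ Finset.Ico (-R i : ℤ) (R i) ×ˢ Finset.Ico (2 ^ τ.1) (2 ^ (τ.1 + 1)),
        e.symm z ∈ Finset.Ico σ.2 τ.2 := by
    rintro i ⟨N₀, n₀⟩
    -- the first `n₀` terms of the enumeration have second index below `N < 2 ^ N`
    set N := N₀ + 1 + (k i + i) + (Finset.range n₀).sup fun j => (e j).2 with hN
    set P := Finset.Ico (-R i : ℤ) (R i) ×ˢ Finset.Ico (2 ^ N) (2 ^ (N + 1))
    refine ⟨(N, n₀ + 1 + P.sup e.symm), by simp only [hN]; omega, by simp only; omega,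
      by simp only [hN]; omega, fun z hz => Finset.mem_Ico.mpr ⟨?_, ?_⟩⟩
    · by_contra! h
      have h1 : (e (e.symm z)).2 ≤ (Finset.range n₀).sup fun j => (e j).2 :=
        Finset.le_sup (f := fun j => (e j).2) (Finset.mem_range.mpr h)
      rw [Equiv.apply_symm_apply] at h1
      have h2 := (Finset.mem_Ico.mp (Finset.mem_product.mp hz).2).1
      have h3 : N < 2 ^ N := Nat.lt_two_pow_self
      simp only at h2
      omega
    · have : e.symm z ≤ P.sup e.symm := Finset.le_sup (f := e.symm) hz
      simp only
      omega
  choose τ h1 h2 h3 h4 using step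
  let σ : ℕ → ℕ × ℕ := fun i => Nat.rec (0, 0) τ i
  exact ⟨fun i => (σ (i + 1)).1, fun i => (σ i).2, strictMono_nat_of_lt_succ fun i => h1 _ _,
    strictMono_nat_of_lt_succ fun i => h2 _ _, fun i => ⟨h3 _ _, h4 _ _⟩⟩

/-- Coefficients prescribed on successive intervals glue to one sequence. -/
theorem exists_glue {n : ℕ → ℕ} (hn : StrictMono n) (D : ℕ → ℕ → ℝ) :
    ∃ a : ℕ → ℝ, ∀ i, ∀ j ∈ Finset.Ico (n i) (n (i + 1)), a j = D i j := by
  refine ⟨fun j => D (Nat.findGreatest (fun i => n i ≤ j) j) j, fun i j hj => ?_⟩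
  rw [Finset.mem_Ico] at hj
  have : Nat.findGreatest (fun i => n i ≤ j) j = i := by
    rw [Nat.findGreatest_eq_iff]
    refine ⟨hn.le_apply.trans hj.1, fun _ => hj.1, fun l hl _ h => ?_⟩
    exact absurd (hj.2.trans_le (hn.monotone hl)) (not_lt.mpr h)
  simp only [this]

end StepFunctions

/-! ### Random signs in `L_p` -/

section RandomSignsLp

variable {α : Type*} [MeasurableSpace α] {μ : Measure α} {p : ℝ≥0∞}

theorem toReal_pos_of_one_le [hp1 : Fact (1 ≤ p)] (hp : p ≠ ∞) : 0 < p.toReal :=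
  ENNReal.toReal_pos (zero_lt_one.trans_le hp1.out).ne' hp

theorem enorm_rpow_eq_lintegral [hp1 : Fact (1 ≤ p)] (hp : p ≠ ∞) (h : Lp ℝ p μ) {H : α → ℝ}
    (hH : h =ᵐ[μ] H) : ‖h‖ₑ ^ p.toReal = ∫⁻ x, ‖H x‖ₑ ^ p.toReal ∂μ := by
  have hq := toReal_pos_of_one_le hp
  rw [Lp.enorm_def, eLpNorm_congr_ae hH,
    eLpNorm_eq_lintegral_rpow_enorm_toReal (zero_lt_one.trans_le hp1.out).ne' hp,
    ← ENNReal.rpow_mul, one_div, inv_mul_cancel₀ hq.ne', ENNReal.rpow_one]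

theorem sum_smul_coeFn (s : Finset ℕ) (a : ℕ → ℝ) (h : ℕ → Lp ℝ p μ) {H : ℕ → α → ℝ}
    (hH : ∀ i, h i =ᵐ[μ] H i) :
    (∑ i ∈ s, a i • h i : Lp ℝ p μ) =ᵐ[μ] fun x => ∑ i ∈ s, a i * H i x := by
  have h1 : ∀ i ∈ s, ((a i • h i : Lp ℝ p μ) : α → ℝ) =ᵐ[μ] fun x => a i * H i x := by
    intro i _
    filter_upwards [Lp.coeFn_smul (a i) (h i), hH i] with x hx1 hx2
    rw [hx1, Pi.smul_apply, hx2, smul_eq_mul]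
  filter_upwards [(ae_ball_iff s.countable_toSet).mpr h1,
    Lp.coeFn_finsetSum s fun i => a i • h i] with x hx1 hx2
  rw [hx2, Finset.sum_apply]
  exact Finset.sum_congr rfl hx1

theorem ofReal_norm_rpow {E : Type*} [SeminormedAddCommGroup E] {q : ℝ} (hq : 0 < q) (x : E) :
    ENNReal.ofReal (‖x‖ ^ q) = ‖x‖ₑ ^ q := by
  rw [← ENNReal.ofReal_rpow_of_nonneg (norm_nonneg _) hq.le, ofReal_norm]

theorem ofReal_sum_norm_rpow_signOf [Fact (1 ≤ p)] (hp : p ≠ ∞) (s : Finset ℕ)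
    (h : ℕ → Lp ℝ p μ) :
    ENNReal.ofReal (∑ t ∈ s.powerset, ‖∑ i ∈ s, signOf t i • h i‖ ^ p.toReal)
      = ∫⁻ x, ENNReal.ofReal
          (∑ t ∈ s.powerset, |∑ i ∈ s, h i x * signOf t i| ^ p.toReal) ∂μ := by
  have hq := toReal_pos_of_one_le hp
  rw [ENNReal.ofReal_sum_of_nonneg fun _ _ => by positivity]
  simp_rw [ENNReal.ofReal_sum_of_nonneg fun _ _ => Real.rpow_nonneg (abs_nonneg _) _]
  rw [lintegral_finsetSum']
  · refine Finset.sum_congr rfl fun t _ => ?_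
    rw [ofReal_norm_rpow hq, enorm_rpow_eq_lintegral hp _
      (sum_smul_coeFn s (signOf t) h fun i => Filter.EventuallyEq.rfl)]
    refine lintegral_congr fun x => ?_
    rw [← ofReal_norm_rpow hq, Real.norm_eq_abs]
    simp only [mul_comm]
  · intro t _
    have : AEMeasurable (fun x => ∑ i ∈ s, h i x * signOf t i) μ :=
      Finset.aemeasurable_fun_sum _ fun i _ =>
        ((Lp.aestronglyMeasurable (h i)).aemeasurable.mul_const _)
    fun_prop

/-- The cotype inequality of `L_p` for `p ≥ 2`. -/
theorem sum_norm_rpow_le_sum_signOf [Fact (1 ≤ p)] (hp : p ≠ ∞) (hp2 : 2 ≤ p.toReal)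
    (s : Finset ℕ) (h : ℕ → Lp ℝ p μ) :
    2 ^ s.card * ∑ i ∈ s, ‖h i‖ ^ p.toReal
      ≤ ∑ t ∈ s.powerset, ‖∑ i ∈ s, signOf t i • h i‖ ^ p.toReal := by
  have hq := toReal_pos_of_one_le hp
  have hR : 0 ≤ ∑ t ∈ s.powerset, ‖∑ i ∈ s, signOf t i • h i‖ ^ p.toReal := by positivity
  rw [← ENNReal.ofReal_le_ofReal_iff hR, ofReal_sum_norm_rpow_signOf hp]
  calc _ = ∫⁻ x, ENNReal.ofReal (2 ^ s.card * ∑ i ∈ s, |h i x| ^ p.toReal) ∂μ := by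
        simp_rw [ENNReal.ofReal_mul (show (0 : ℝ) ≤ 2 ^ s.card by positivity),
          ENNReal.ofReal_sum_of_nonneg fun _ _ => Real.rpow_nonneg (abs_nonneg _) _]
        rw [ENNReal.ofReal_sum_of_nonneg fun _ _ => Real.rpow_nonneg (norm_nonneg _) _,
          lintegral_const_mul' _ _ ENNReal.ofReal_ne_top, lintegral_finsetSum']
        · congr 1
          refine Finset.sum_congr rfl fun i _ => ?_
          rw [ofReal_norm_rpow hq, enorm_rpow_eq_lintegral hp _ Filter.EventuallyEq.rfl]
          refine lintegral_congr fun x => ?_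
          rw [← ofReal_norm_rpow hq, Real.norm_eq_abs]
        · intro i _
          have := (Lp.aestronglyMeasurable (h i)).aemeasurable
          fun_prop
    _ ≤ _ := lintegral_mono fun x =>
        ENNReal.ofReal_le_ofReal (sum_rpow_le_sum_powerset_signOf hp2 s fun i => h i x)

/-- The type 2 inequality of `L_p` for `2 ≤ p ≤ 4`: Khintchine's inequality at each point, and
Minkowski's inequality in `L_{p/2}`. -/
theorem sum_signOf_norm_rpow_le [Fact (1 ≤ p)] (hp : p ≠ ∞) (hp2 : 2 ≤ p.toReal)
    (hp4 : p.toReal ≤ 4) (s : Finset ℕ) (h : ℕ → Lp ℝ p μ) :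
    ∑ t ∈ s.powerset, ‖∑ i ∈ s, signOf t i • h i‖ ^ p.toReal
      ≤ 2 ^ s.card * (3 * (∑ i ∈ s, ‖h i‖ ^ 2) ^ (p.toReal / 2)) := by
  have hq := toReal_pos_of_one_le hp
  have hR : 0 ≤ 2 ^ s.card * (3 * (∑ i ∈ s, ‖h i‖ ^ 2) ^ (p.toReal / 2)) := by positivity
  rw [← ENNReal.ofReal_le_ofReal_iff hR, ofReal_sum_norm_rpow_signOf hp]
  have hp22 : p / 2 * ENNReal.ofReal 2 = p := by
    rw [show ENNReal.ofReal 2 = 2 by norm_num]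
    exact ENNReal.div_mul_cancel (by norm_num) (by norm_num)
  have hp2r : (p / 2).toReal = p.toReal / 2 := by rw [ENNReal.toReal_div]; norm_num
  have hp20 : p / 2 ≠ 0 := by
    intro h0; rw [h0] at hp2r; simp at hp2r; linarith
  have hp2t : p / 2 ≠ ∞ := ENNReal.div_ne_top hp (by norm_num)
  have hp21 : 1 ≤ p / 2 := by
    rw [← ENNReal.toReal_le_toReal (by norm_num) hp2t, hp2r]; simp; linarith
  have hmink : eLpNorm (∑ i ∈ s, fun x => ‖h i x‖ ^ (2 : ℝ)) (p / 2) μ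
      ≤ ENNReal.ofReal (∑ i ∈ s, ‖h i‖ ^ 2) := by
    refine (eLpNorm_sum_le (fun i _ => ?_) hp21).trans ?_
    · have := (Lp.aestronglyMeasurable (h i)).aemeasurable
      exact AEMeasurable.aestronglyMeasurable (by fun_prop)
    · rw [ENNReal.ofReal_sum_of_nonneg fun _ _ => by positivity]
      refine Finset.sum_le_sum fun i _ => ?_
      rw [eLpNorm_norm_rpow _ (by norm_num), hp22, ← Lp.enorm_def, ← ofReal_norm_rpow (by norm_num)]
      simp
  calc _ ≤ ∫⁻ x, ENNReal.ofReal (2 ^ s.card * 3) *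
          ‖(∑ i ∈ s, fun x => ‖h i x‖ ^ (2 : ℝ)) x‖ₑ ^ (p / 2).toReal ∂μ := by
        refine lintegral_mono fun x => ?_
        refine (ENNReal.ofReal_le_ofReal
          (sum_powerset_signOf_rpow_le hq hp4 s fun i => h i x)).trans (le_of_eq ?_)
        have h0 : 0 < (p / 2).toReal := by rw [hp2r]; linarith
        have h1 : ‖(∑ i ∈ s, fun x => ‖h i x‖ ^ (2 : ℝ)) x‖ = ∑ i ∈ s, h i x ^ 2 := by
          rw [Finset.sum_apply, Real.norm_of_nonneg (Finset.sum_nonneg fun _ _ => by positivity)]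
          simp
        rw [← mul_assoc, ENNReal.ofReal_mul (by positivity), ← ofReal_norm_rpow h0, h1, hp2r]
    _ = ENNReal.ofReal (2 ^ s.card * 3) *
          (eLpNorm (∑ i ∈ s, fun x => ‖h i x‖ ^ (2 : ℝ)) (p / 2) μ) ^ (p / 2).toReal := by
        rw [lintegral_const_mul' _ _ ENNReal.ofReal_ne_top,
          eLpNorm_eq_lintegral_rpow_enorm_toReal hp20 hp2t, ← ENNReal.rpow_mul, one_div,
          inv_mul_cancel₀, ENNReal.rpow_one]
        rw [hp2r]; linarith
    _ ≤ ENNReal.ofReal (2 ^ s.card * 3) *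
          (ENNReal.ofReal (∑ i ∈ s, ‖h i‖ ^ 2)) ^ (p / 2).toReal := by gcongr
    _ = _ := by
        rw [ENNReal.ofReal_rpow_of_nonneg (by positivity) (by positivity),
          ← ENNReal.ofReal_mul (by positivity), hp2r, mul_assoc]

end RandomSignsLp

section Modulation

variable {p : ℝ≥0∞} [Fact (1 ≤ p)]

theorem norm_LpToLpRestrictCLM_eq (J : Set ℝ) (h : Lp ℝ p (volume : Measure ℝ)) :
    ‖LpToLpRestrictCLM ℝ ℝ ℝ volume p J h‖ = (eLpNorm h p (volume.restrict J)).toReal := by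
  rw [Lp.norm_def, eLpNorm_congr_ae (LpToLpRestrictCLM_coeFn ℝ J h)]

theorem norm_LpToLpRestrictCLM_mono {I J : Set ℝ} (hIJ : I ⊆ J)
    (h : Lp ℝ p (volume : Measure ℝ)) :
    ‖LpToLpRestrictCLM ℝ ℝ ℝ volume p I h‖ ≤ ‖LpToLpRestrictCLM ℝ ℝ ℝ volume p J h‖ := by
  rw [norm_LpToLpRestrictCLM_eq, norm_LpToLpRestrictCLM_eq]
  refine ENNReal.toReal_mono ?_ (eLpNorm_mono_measure _ (Measure.restrict_mono hIJ le_rfl))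
  exact (lt_of_le_of_lt (eLpNorm_mono_measure _ Measure.restrict_le_self) (Lp.eLpNorm_lt_top h)).ne

theorem norm_LpToLpRestrictCLM_le (J : Set ℝ) (h : Lp ℝ p (volume : Measure ℝ)) :
    ‖LpToLpRestrictCLM ℝ ℝ ℝ volume p J h‖ ≤ ‖h‖ := by
  rw [norm_LpToLpRestrictCLM_eq, Lp.norm_def]
  exact ENNReal.toReal_mono (Lp.eLpNorm_ne_top h)
    (eLpNorm_mono_measure _ Measure.restrict_le_self)

theorem norm_LpToLpRestrictCLM_univ (h : Lp ℝ p (volume : Measure ℝ)) :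
    ‖LpToLpRestrictCLM ℝ ℝ ℝ volume p Set.univ h‖ = ‖h‖ := by
  rw [norm_LpToLpRestrictCLM_eq, Lp.norm_def, Measure.restrict_univ]

/-- On every union `J` of unit intervals, the norm of a combination of the modulated sequence is
the average over all signs of the norms of the signed combinations of the original sequence. -/
theorem norm_rpow_sum_modulate (hp : p ≠ ∞) {N k : ℕ → ℕ} (hN : StrictMono N) {u : ℕ → ℝ → ℝ}
    (hu : ∀ i, DyadicConst (k i) (u i)) (hk : ∀ i, k i + i ≤ N i) {J : Set ℝ}
    (hJ : DyadicConst 0 (· ∈ J)) {g U : ℕ → Lp ℝ p (volume : Measure ℝ)}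
    (hg : ∀ i, g i =ᵐ[volume] modulate N u i) (hU : ∀ i, U i =ᵐ[volume] u i) (a : ℕ → ℝ)
    (n : ℕ) :
    2 ^ n * ‖LpToLpRestrictCLM ℝ ℝ ℝ volume p J (∑ i ∈ Finset.range n, a i • g i)‖ ^ p.toReal
      = ∑ t ∈ (Finset.range n).powerset, ‖∑ i ∈ Finset.range n,
          signOf t i • a i • LpToLpRestrictCLM ℝ ℝ ℝ volume p J (U i)‖ ^ p.toReal := by
  have hq := toReal_pos_of_one_le hp
  have key := lintegral_modulate hN hu hk hJ (φ := fun x => ‖x‖ₑ ^ p.toReal) (by fun_prop) a n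
    (w := fun _ => 0) measurable_const
  simp only [zero_add] at key
  have hrep : ∀ (h : Lp ℝ p (volume : Measure ℝ)) (H : ℝ → ℝ), h =ᵐ[volume] H →
      ‖LpToLpRestrictCLM ℝ ℝ ℝ volume p J h‖ₑ ^ p.toReal
        = ∫⁻ x in J, ‖H x‖ₑ ^ p.toReal := fun h H hH =>
    enorm_rpow_eq_lintegral hp _ ((LpToLpRestrictCLM_coeFn ℝ J h).trans (ae_restrict_of_ae hH))
  rw [← hrep _ _ (sum_smul_coeFn _ a g hg)] at key
  have key2 : ∀ t : Finset ℕ, ∫⁻ x in J,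
      ‖∑ i ∈ Finset.range n, a i * signOf t i * u i x‖ₑ ^ p.toReal
      = ‖∑ i ∈ Finset.range n,
          signOf t i • a i • LpToLpRestrictCLM ℝ ℝ ℝ volume p J (U i)‖ₑ ^ p.toReal := fun t => by
    rw [← hrep _ _ (sum_smul_coeFn _ (fun i => a i * signOf t i) U hU), map_sum]
    simp only [map_smul, smul_smul, mul_comm]
  simp only [key2] at key
  simp only [← ofReal_norm_rpow hq] at key
  rw [← ENNReal.ofReal_sum_of_nonneg fun _ _ => by positivity] at key
  have h2 : ((2 : ℝ≥0∞) ^ n)⁻¹ = ENNReal.ofReal ((2 ^ n)⁻¹) := by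
    rw [ENNReal.ofReal_inv_of_pos (by positivity), ENNReal.ofReal_pow (by norm_num)]; norm_num
  rw [h2, ← ENNReal.ofReal_mul (by positivity),
    ENNReal.ofReal_eq_ofReal_iff (by positivity) (by positivity)] at key
  rw [key, mul_inv_cancel_left₀ (by positivity)]

end Modulation

/-! ### Translates of one function -/

section Translates

variable {p : ℝ≥0∞}

theorem translateLp_coeFn (t : ℝ) (f : Lp ℝ p (volume : Measure ℝ)) :
    translateLp p t f =ᵐ[volume] fun x => f (x - t) :=
  Lp.coeFn_compMeasurePreserving f (measurePreserving_sub_right volume t)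

theorem norm_translateLp (t : ℝ) (f : Lp ℝ p (volume : Measure ℝ)) : ‖translateLp p t f‖ = ‖f‖ :=
  Lp.norm_compMeasurePreserving f (measurePreserving_sub_right volume t)

theorem norm_translateLp_sub (s t : ℝ) (f : Lp ℝ p (volume : Measure ℝ)) :
    ‖translateLp p s f - translateLp p t f‖ = ‖translateLp p (s - t) f - f‖ := by
  rw [← norm_translateLp t (translateLp p (s - t) f - f)]
  congr 1
  apply Lp.ext
  have hqm := (measurePreserving_sub_right (volume : Measure ℝ) t).quasiMeasurePreserving
  filter_upwards [Lp.coeFn_sub (translateLp p s f) (translateLp p t f), translateLp_coeFn s f,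
    translateLp_coeFn t f, translateLp_coeFn t (translateLp p (s - t) f - f),
    hqm.ae (Lp.coeFn_sub (translateLp p (s - t) f) f),
    hqm.ae (translateLp_coeFn (s - t) f)] with x h1 h2 h3 h4 h5 h6
  rw [h1, h4, h5, Pi.sub_apply, Pi.sub_apply, h2, h3, h6]
  congr 2
  ring

theorem translateLp_zero (f : Lp ℝ p (volume : Measure ℝ)) : translateLp p 0 f = f := by
  apply Lp.ext
  filter_upwards [translateLp_coeFn 0 f] with x hx
  rw [hx, sub_zero]

variable [Fact (1 ≤ p)]

theorem continuous_translateLp (hp : p ≠ ∞) (f : Lp ℝ p (volume : Measure ℝ)) :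
    Continuous fun t => translateLp p t f := by
  let G : C(ℝ, C(ℝ, ℝ)) :=
    (ContinuousMap.mk (fun a : ℝ × ℝ => a.2 - a.1) (by fun_prop)).curry
  exact (continuous_const (y := f)).compMeasurePreservingLp G.continuous
    (fun t => measurePreserving_sub_right volume t) hp

/-- The shifts of an unconditional basic sequence of translates are uniformly separated: its
terms are uniformly separated and translation is norm continuous. -/
theorem exists_separation (hp : p ≠ ∞) {f : Lp ℝ p (volume : Measure ℝ)} {lam : ℕ → ℝ}
    (hf : IsUnconditionalBasicSeq fun i => translateLp p (lam i) f) :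
    ∃ δ : ℝ, 0 < δ ∧ ∀ i j, i ≠ j → δ ≤ |lam i - lam j| := by
  obtain ⟨K, hK0, hK⟩ := hf.exists_norm_sum_le
  have hf0 : 0 < ‖f‖ := by
    rw [← norm_translateLp (lam 0) f]; exact norm_pos_iff.mpr (hf.ne_zero 0)
  obtain ⟨δ, hδ, h⟩ := Metric.continuous_iff.mp (continuous_translateLp hp f) 0 (‖f‖ / K)
    (by positivity)
  refine ⟨δ, hδ, fun i j hij => ?_⟩
  by_contra! hlt
  have h1 := h (lam i - lam j) (by rwa [dist_zero_right])
  rw [dist_eq_norm, translateLp_zero, ← norm_translateLp_sub, lt_div_iff₀ hK0, mul_comm] at h1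
  have h2 := hK {i, j} {i} (fun l => if l = i then 1 else -1) (by simp)
  rw [Finset.sum_pair hij] at h2
  simp only [Finset.sum_singleton, if_true, if_neg hij.symm, one_smul, neg_smul,
    ← sub_eq_add_neg, norm_translateLp] at h2
  linarith

/-- A uniformly separated family of translates of one function has `p`-summable norms on every
bounded interval. -/
theorem exists_sum_norm_restrict_translateLp_le (hp : p ≠ ∞) (f : Lp ℝ p (volume : Measure ℝ))
    {lam : ℕ → ℝ} {δ : ℝ} (hδ : 0 < δ) (hlam : ∀ i j, i ≠ j → δ ≤ |lam i - lam j|) (M : ℕ) :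
    ∃ C : ℝ, 0 ≤ C ∧ ∀ s : Finset ℕ,
      ∑ i ∈ s, ‖LpToLpRestrictCLM ℝ ℝ ℝ volume p (Set.Ico (-M : ℝ) M)
        (translateLp p (lam i) f)‖ ^ p.toReal ≤ C := by
  have hq := toReal_pos_of_one_le hp
  set J := Set.Ico (-M : ℝ) M with hJ
  set B : Finset ℤ := Finset.Icc ⌊-M / δ⌋ ⌊M / δ⌋ with hB
  -- for fixed `y` the integers `⌊(y + lam i) / δ⌋` are distinct by separation
  have hcount : ∀ (s : Finset ℕ) (y : ℝ), (s.filter fun i => y + lam i ∈ J).card ≤ B.card := by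
    intro s y
    refine Finset.card_le_card_of_injOn (fun i => ⌊(y + lam i) / δ⌋) ?_ ?_
    · intro i hi
      have h := (Finset.mem_filter.mp hi).2
      simp only [hB, Finset.coe_Icc, Set.mem_Icc]
      constructor
      · exact Int.floor_mono (by have := h.1; gcongr)
      · exact Int.floor_mono (by have := h.2.le; gcongr)
    · intro i _ j _ hij
      by_contra hne
      have h1 := hlam i j hne
      have h2 := Int.abs_sub_lt_one_of_floor_eq_floor hij
      rw [← sub_div, abs_div, abs_of_pos hδ, div_lt_one hδ, add_sub_add_left_eq_sub] at h2
      linarith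
  refine ⟨B.card * ‖f‖ ^ p.toReal, by positivity, fun s => ?_⟩
  rw [← ENNReal.ofReal_le_ofReal_iff (by positivity),
    ENNReal.ofReal_sum_of_nonneg fun _ _ => by positivity,
    ENNReal.ofReal_mul (by positivity), ofReal_norm_rpow hq,
    enorm_rpow_eq_lintegral hp f Filter.EventuallyEq.rfl, ENNReal.ofReal_natCast]
  set w : ℝ → ℝ≥0∞ := fun y => ‖f y‖ₑ ^ p.toReal with hw
  have hwm : AEMeasurable w := by
    have := (Lp.aestronglyMeasurable f).aemeasurable
    fun_prop
  have hterm : ∀ i, ENNReal.ofReal (‖LpToLpRestrictCLM ℝ ℝ ℝ volume p J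
      (translateLp p (lam i) f)‖ ^ p.toReal)
      = ∫⁻ y, J.indicator (fun _ => 1) (y + lam i) * w y := by
    intro i
    rw [ofReal_norm_rpow hq, enorm_rpow_eq_lintegral hp _
      ((LpToLpRestrictCLM_coeFn ℝ J _).trans (ae_restrict_of_ae (translateLp_coeFn (lam i) f))),
      ← lintegral_indicator (measurableSet_Ico : MeasurableSet J),
      ← lintegral_add_right_eq_self _ (lam i)]
    refine lintegral_congr fun y => ?_
    by_cases hy : y + lam i ∈ J
    · simp [← hJ, Set.indicator_of_mem hy, hw]
    · simp [← hJ, Set.indicator_of_notMem hy]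
  simp only [hterm]
  rw [← lintegral_finsetSum', ← lintegral_const_mul' _ _ (ENNReal.natCast_ne_top _)]
  · refine lintegral_mono fun y => ?_
    rw [← Finset.sum_mul]
    gcongr
    simp only [Set.indicator_apply, Finset.sum_boole]
    exact_mod_cast hcount s y
  · intro i _
    refine AEMeasurable.mul ?_ hwm
    exact ((measurable_const.indicator measurableSet_Ico).comp
      (measurable_id.add_const _)).aemeasurable

end Translates

/-! ### Compactness and perturbation -/

section Abstract

variable {X Z : Type*} [NormedAddCommGroup X] [NormedSpace ℝ X]
  [NormedAddCommGroup Z] [NormedSpace ℝ Z]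

/-- An operator whose norms on the tails of a basic sequence tend to zero is compact, as a norm
limit of finite rank operators. -/
theorem IsBasicSeq.isCompactOperator [CompleteSpace Z] {g : ℕ → X} (hg : IsBasicSeq g)
    (T : X →L[ℝ] Z) {τ : ℕ → ℝ} (hτ : Filter.Tendsto τ Filter.atTop (nhds 0))
    (hτ0 : ∀ n, 0 ≤ τ n)
    (hT : ∀ (n M : ℕ) (a : ℕ → ℝ), n ≤ M →
      ‖T (∑ i ∈ Finset.Ico n M, a i • g i)‖ ≤ τ n * ‖∑ i ∈ Finset.range M, a i • g i‖) :
    IsCompactOperator (T.comp (closedSpan g).subtypeL) := by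
  obtain ⟨b, hb⟩ := hg
  set S := T.comp (closedSpan g).subtypeL with hS
  have hproj : ∀ n y, ((b.proj n y : closedSpan g) : X)
      = ∑ i ∈ Finset.range n, b.coord i y • g i := fun n y => by
    rw [SchauderBasis.proj_apply]; simp [hb]
  have hfin : ∀ n, IsCompactOperator (S.comp (b.proj n)) := fun n => by
    have hfd : FiniteDimensional ℝ (b.proj n).toLinearMap.range := by
      rw [SchauderBasis.range_proj_eq_span]
      exact FiniteDimensional.span_of_finite ℝ ((Finset.finite_toSet _).image _)
    have := FiniteDimensional.proper ℝ (b.proj n).toLinearMap.range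
    let P : closedSpan g →L[ℝ] (b.proj n).toLinearMap.range :=
      (b.proj n).codRestrict _ fun y => LinearMap.mem_range_self _ y
    have hP : IsCompactOperator P := isCompactOperator_of_locallyCompactSpace_dom P
    exact hP.clm_comp (S.comp (b.proj n).toLinearMap.range.subtypeL)
  have hdiff : ∀ n, ‖S.comp (b.proj n) - S‖ ≤ τ n := fun n => by
    refine ContinuousLinearMap.opNorm_le_bound _ (hτ0 n) fun y => ?_
    have hlim := b.tendsto_proj y
    have h1 : Filter.Tendsto (fun M => ‖S (b.proj n y) - S (b.proj M y)‖) Filter.atTop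
        (nhds ‖S (b.proj n y) - S y‖) :=
      (tendsto_const_nhds.sub ((S.continuous.tendsto y).comp hlim)).norm
    have h2 : Filter.Tendsto (fun M => τ n * ‖b.proj M y‖) Filter.atTop (nhds (τ n * ‖y‖)) :=
      hlim.norm.const_mul _
    refine le_of_tendsto_of_tendsto h1 h2 (Filter.eventually_atTop.mpr ⟨n, fun M hM => ?_⟩)
    have h3 : S (b.proj M y) - S (b.proj n y)
        = T (∑ i ∈ Finset.Ico n M, b.coord i y • g i) := by
      rw [Finset.sum_Ico_eq_sub _ hM, map_sub, ← hproj, ← hproj]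
      rfl
    refine (le_of_eq (norm_sub_rev _ _)).trans ?_
    rw [h3]
    refine (hT n M _ hM).trans (le_of_eq ?_)
    rw [← hproj]
    rfl
  refine isCompactOperator_of_tendsto (l := Filter.atTop) (F := fun n => S.comp (b.proj n)) ?_
    (Filter.Eventually.of_forall hfin)
  rw [tendsto_iff_norm_sub_tendsto_zero]
  exact squeeze_zero (fun _ => norm_nonneg _) hdiff hτ

theorem norm_smul_le_of_projections {x : ℕ → X} {K : ℝ}
    (hK : ∀ (s A : Finset ℕ) (a : ℕ → ℝ), A ⊆ s →
      ‖∑ i ∈ A, a i • x i‖ ≤ K * ‖∑ i ∈ s, a i • x i‖)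
    {s : Finset ℕ} {i : ℕ} (hi : i ∈ s) (a : ℕ → ℝ) :
    |a i| * ‖x i‖ ≤ K * ‖∑ i ∈ s, a i • x i‖ := by
  have := hK s {i} a (Finset.singleton_subset_iff.mpr hi)
  rwa [Finset.sum_singleton, norm_smul, Real.norm_eq_abs] at this

/-- Signed sums of a small perturbation of an unconditional sequence are comparable with the
unsigned sums of the original one. The constant in `hU` makes the total error at most half of the
lower bound `‖∑ a_i x_i‖ / (2 K)` for signed sums of the `x i`. -/
theorem norm_sum_signOf_perturb {x U : ℕ → X} {K B : ℝ} (hK0 : 0 < K) (hB : 0 < B)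
    (hxB : ∀ i, ‖x i‖ = B)
    (hK : ∀ (s A : Finset ℕ) (a : ℕ → ℝ), A ⊆ s →
      ‖∑ i ∈ A, a i • x i‖ ≤ K * ‖∑ i ∈ s, a i • x i‖)
    (hU : ∀ i, ‖x i - U i‖ ≤ B / (8 * K ^ 2) * (1 / 2) ^ i) (s t : Finset ℕ) (a : ℕ → ℝ) :
    1 / (4 * K) * ‖∑ i ∈ s, a i • x i‖ ≤ ‖∑ i ∈ s, signOf t i • a i • U i‖ ∧
      ‖∑ i ∈ s, signOf t i • a i • U i‖ ≤ (2 * K + 1 / (4 * K)) * ‖∑ i ∈ s, a i • x i‖ := by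
  set x' := ∑ i ∈ s, a i • x i with hx'
  have hsq : ∀ i, signOf t i * signOf t i = 1 := fun i => by unfold signOf; split_ifs <;> norm_num
  have habs : ∀ i, |signOf t i| = 1 := fun i => by unfold signOf; split_ifs <;> norm_num
  have h1 : ‖∑ i ∈ s, signOf t i • a i • x i‖ ≤ 2 * K * ‖x'‖ := by
    have := norm_sum_signOf_le hK s t a
    simpa only [smul_smul, mul_comm (signOf t _)] using this
  have h2 : ‖x'‖ ≤ 2 * K * ‖∑ i ∈ s, signOf t i • a i • x i‖ := by
    have := norm_sum_signOf_le hK s t fun i => a i * signOf t i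
    simpa only [smul_smul, mul_assoc, hsq, mul_one, mul_comm (signOf t _)] using this
  have h3 : ‖∑ i ∈ s, signOf t i • a i • x i - ∑ i ∈ s, signOf t i • a i • U i‖
      ≤ 1 / (4 * K) * ‖x'‖ := by
    rw [← Finset.sum_sub_distrib]
    calc _ ≤ ∑ i ∈ s, K * ‖x'‖ / B * (B / (8 * K ^ 2) * (1 / 2) ^ i) := by
          refine norm_sum_le_of_le _ fun i hi => ?_
          rw [← smul_sub, ← smul_sub, norm_smul, norm_smul, Real.norm_eq_abs, habs, one_mul,
            Real.norm_eq_abs]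
          have := norm_smul_le_of_projections hK hi a
          rw [hxB, ← le_div_iff₀ hB] at this
          exact mul_le_mul this (hU i) (norm_nonneg _) (by positivity)
      _ = 1 / (8 * K) * ‖x'‖ * ∑ i ∈ s, (1 / 2 : ℝ) ^ i := by
          rw [Finset.mul_sum]
          refine Finset.sum_congr rfl fun i _ => ?_
          field_simp
      _ ≤ 1 / (8 * K) * ‖x'‖ * 2 := by
          gcongr
          exact (summable_geometric_two.sum_le_tsum s fun i _ => by positivity).trans
            tsum_geometric_two.le
      _ = _ := by field_simp; ring
  have h4 : 1 / (2 * K) * ‖x'‖ ≤ ‖∑ i ∈ s, signOf t i • a i • x i‖ := by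
    rw [one_div, inv_mul_le_iff₀ (by positivity)]; exact h2
  have h5 : 1 / (2 * K) * ‖x'‖ = 1 / (4 * K) * ‖x'‖ + 1 / (4 * K) * ‖x'‖ := by field_simp; ring
  have h6 := norm_sub_norm_le (∑ i ∈ s, signOf t i • a i • x i)
    (∑ i ∈ s, signOf t i • a i • U i)
  have h7 := norm_sub_norm_le (∑ i ∈ s, signOf t i • a i • U i)
    (∑ i ∈ s, signOf t i • a i • x i)
  rw [norm_sub_rev] at h7
  constructor
  · linarith
  · linarith

end Abstract

theorem sum_pow_four_le_of_sum_rpow_le {q A : ℝ} (hq : 0 < q) (hq4 : q ≤ 4) (hA : 0 ≤ A)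
    {s : Finset ℕ} {c : ℕ → ℝ} (h : ∑ i ∈ s, |c i| ^ q ≤ A ^ q) : ∑ i ∈ s, c i ^ 4 ≤ A ^ 4 := by
  have h4 : ∀ y : ℝ, 0 ≤ y → y ^ 4 = y ^ q * y ^ (4 - q) := fun y hy => by
    rw [← Real.rpow_add_of_nonneg hy hq.le (by linarith), add_sub_cancel,
      show (4 : ℝ) = ((4 : ℕ) : ℝ) by norm_num, Real.rpow_natCast]
  have hle : ∀ i ∈ s, |c i| ≤ A := fun i hi => by
    rw [← Real.rpow_le_rpow_iff (abs_nonneg _) hA hq]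
    exact (Finset.single_le_sum (f := fun i => |c i| ^ q)
      (fun _ _ => Real.rpow_nonneg (abs_nonneg _) _) hi).trans h
  calc ∑ i ∈ s, c i ^ 4 ≤ ∑ i ∈ s, |c i| ^ q * A ^ (4 - q) := by
        refine Finset.sum_le_sum fun i hi => ?_
        rw [← Even.pow_abs (by decide : Even 4), h4 _ (abs_nonneg _)]
        exact mul_le_mul_of_nonneg_left
          (Real.rpow_le_rpow (abs_nonneg _) (hle i hi) (by linarith)) (by positivity)
    _ ≤ A ^ q * A ^ (4 - q) := by rw [← Finset.sum_mul]; gcongr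
    _ = A ^ 4 := (h4 A hA).symm

/-- Taking the average of `q`-th powers preserves two-sided bounds. -/
theorem bounds_of_two_pow_mul_rpow_eq {q y l r : ℝ} (hq : 0 < q) (hy : 0 ≤ y) (hl : 0 ≤ l)
    (hr : 0 ≤ r) {n : ℕ} {v : Finset ℕ → ℝ}
    (h : 2 ^ n * y ^ q = ∑ t ∈ (Finset.range n).powerset, v t ^ q) (hlv : ∀ t, l ≤ v t)
    (hvr : ∀ t, v t ≤ r) : l ≤ y ∧ y ≤ r := by
  have h2 : (0 : ℝ) < 2 ^ n := by positivity
  have hconst : ∀ c : ℝ, ∑ _t ∈ (Finset.range n).powerset, c = 2 ^ n * c := fun c => by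
    simp
  constructor
  · rw [← Real.rpow_le_rpow_iff hl hy hq, ← mul_le_mul_iff_right₀ h2, h, ← hconst]
    exact Finset.sum_le_sum fun t _ => Real.rpow_le_rpow hl (hlv t) hq.le
  · rw [← Real.rpow_le_rpow_iff hy hr hq, ← mul_le_mul_iff_right₀ h2, h, ← hconst]
    exact Finset.sum_le_sum fun t _ => Real.rpow_le_rpow (hl.trans (hlv t)) (hvr t) hq.le

/-! ### The block basis -/

section BlockBasis

variable {p : ℝ≥0∞}

/-- Blocks of an arbitrarily enumerated Haar system realizing a modulation of a given sequence of
boundedly supported dyadic step functions. -/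
theorem exists_block_modulate (e : ℕ ≃ ℤ × ℕ) {u : ℕ → ℝ → ℝ} {k R : ℕ → ℕ}
    (hu : ∀ i, DyadicConst (k i) (u i))
    (hR : ∀ i x, ⌊x⌋ ∉ Finset.Ico (-R i : ℤ) (R i) → u i x = 0) :
    ∃ (N n : ℕ → ℕ) (a : ℕ → ℝ) (g : ℕ → Lp ℝ p (volume : Measure ℝ)),
      StrictMono N ∧ StrictMono n ∧ (∀ i, k i + i ≤ N i) ∧
      (∀ i, g i = ∑ j ∈ Finset.Ico (n i) (n (i + 1)), a j • haarLp p (e j).1 (e j).2) ∧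
      ∀ i, g i =ᵐ[volume] modulate N u i := by
  obtain ⟨N, n, hN, hn, hNn⟩ := exists_levels e k R
  let v : ℕ → ℝ → ℝ := fun i => u i ∘ deleteDigits N i
  have hv : ∀ i, DyadicConst (N i) (v i) := fun i =>
    ((hu i).comp_deleteDigits N i).mono (hNn i).1
  have hvR : ∀ i x, ⌊x⌋ ∉ Finset.Ico (-R i : ℤ) (R i) → v i x = 0 := fun i x hx =>
    hR i _ (by rwa [floor_deleteDigits])
  let P : ℕ → Finset (ℤ × ℕ) := fun i =>
    Finset.Ico (-R i : ℤ) (R i) ×ˢ Finset.Ico (2 ^ N i) (2 ^ (N i + 1))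
  obtain ⟨a, ha⟩ := exists_glue hn fun i j =>
    if e j ∈ P i then haarCoeff p (N i) (v i) (e j) else 0
  refine ⟨N, n, a, _, hN, hn, fun i => (hNn i).1, fun i => rfl, fun i => ?_⟩
  have hsum : ∑ j ∈ Finset.Ico (n i) (n (i + 1)), a j • haarLp p (e j).1 (e j).2
      = ∑ z ∈ P i, haarCoeff p (N i) (v i) z • haarLp p z.1 z.2 := by
    have hsub : (P i).map e.symm.toEmbedding ⊆ Finset.Ico (n i) (n (i + 1)) := by
      intro j hj
      obtain ⟨z, hz, rfl⟩ := Finset.mem_map.mp hj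
      exact (hNn i).2 z hz
    rw [← Finset.sum_subset hsub, Finset.sum_map]
    · refine Finset.sum_congr rfl fun z hz => ?_
      have h := ha i (e.symm z) ((hNn i).2 z hz)
      simp only [Equiv.apply_symm_apply, if_pos hz] at h
      simp only [Equiv.coe_toEmbedding, Equiv.apply_symm_apply, h]
    · intro j hj hjP
      have h : e j ∉ P i := fun h => hjP (Finset.mem_map.mpr ⟨e j, h, by simp⟩)
      rw [ha i j hj, if_neg h, zero_smul]
  simp only [hsum]
  exact sum_haarCoeff_smul_haarLp_coeFn p (hv i) (hvR i)

variable [Fact (1 ≤ p)]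

theorem dyadicConst_mem_Ico (M : ℕ) : DyadicConst 0 (· ∈ Set.Ico (-M : ℝ) M) := by
  intro x y h
  simp only [pow_zero, one_mul] at h
  simp only [← floor_mem_Ico_iff, h]

theorem sum_finset_eq_sum_range {E : Type*} [AddCommGroup E] [Module ℝ E] (s : Finset ℕ)
    (a : ℕ → ℝ) : ∃ (n : ℕ) (a' : ℕ → ℝ), ∀ y : ℕ → E,
      ∑ i ∈ s, a i • y i = ∑ i ∈ Finset.range n, a' i • y i := by
  obtain ⟨n, hn⟩ := s.exists_nat_subset_range
  refine ⟨n, fun i => if i ∈ s then a i else 0, fun y => ?_⟩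
  rw [← Finset.sum_subset hn]
  · exact Finset.sum_congr rfl fun i hi => by simp [hi]
  · intro i _ hi; simp [hi]

/-- The restricted norm of a block of the modulated sequence is controlled by the `ℓ_q` norm of
the coefficients, through the type 2 inequality and the Cauchy–Schwarz inequality. The latter
needs the coefficients in `ℓ_4`, which is where `p ≤ 4` is used. -/
theorem norm_restrict_sum_modulate_le (hp : p ≠ ∞) (hp2 : 2 ≤ p.toReal) (hp4 : p.toReal ≤ 4)
    {N k : ℕ → ℕ} (hN : StrictMono N) {u : ℕ → ℝ → ℝ}
    (hu : ∀ i, DyadicConst (k i) (u i)) (hk : ∀ i, k i + i ≤ N i) {J : Set ℝ}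
    (hJ : DyadicConst 0 (· ∈ J)) {g U : ℕ → Lp ℝ p (volume : Measure ℝ)}
    (hg : ∀ i, g i =ᵐ[volume] modulate N u i) (hU : ∀ i, U i =ᵐ[volume] u i)
    {n M : ℕ} {a : ℕ → ℝ} {A V : ℝ} (hA : 0 ≤ A)
    (ha : ∑ i ∈ Finset.range M, |a i| ^ p.toReal ≤ A ^ p.toReal)
    (hV : ∑ i ∈ Finset.Ico n M, ‖LpToLpRestrictCLM ℝ ℝ ℝ volume p J (U i)‖ ^ 4 ≤ V) :
    ‖LpToLpRestrictCLM ℝ ℝ ℝ volume p J (∑ i ∈ Finset.Ico n M, a i • g i)‖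
      ≤ 3 * (A * √√V) := by
  have hq := toReal_pos_of_one_le hp
  set q := p.toReal
  set T := LpToLpRestrictCLM ℝ ℝ ℝ volume p J
  have hV0 : 0 ≤ V := le_trans (by positivity) hV
  set b : ℕ → ℝ := fun i => if n ≤ i then a i else 0 with hb
  have hfil : (Finset.range M).filter (n ≤ ·) = Finset.Ico n M := by
    ext i; simp [and_comm]
  have hbg : ∑ i ∈ Finset.range M, b i • g i = ∑ i ∈ Finset.Ico n M, a i • g i := by
    rw [← hfil, Finset.sum_filter]
    refine Finset.sum_congr rfl fun i _ => ?_
    simp only [hb]; split_ifs <;> simp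
  have h2 : (0 : ℝ) < 2 ^ M := by positivity
  have hmain : ‖T (∑ i ∈ Finset.Ico n M, a i • g i)‖ ^ q
      ≤ 3 * (∑ i ∈ Finset.range M, ‖b i • T (U i)‖ ^ 2) ^ (q / 2) := by
    rw [← mul_le_mul_iff_right₀ h2, ← hbg, norm_rpow_sum_modulate hp hN hu hk hJ hg hU b M]
    have := sum_signOf_norm_rpow_le hp hp2 hp4 (Finset.range M) fun i => b i • T (U i)
    rwa [Finset.card_range] at this
  have hS : ∑ i ∈ Finset.range M, ‖b i • T (U i)‖ ^ 2 ≤ (A * √√V) ^ 2 := by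
    have e1 : ∑ i ∈ Finset.range M, ‖b i • T (U i)‖ ^ 2
        = ∑ i ∈ Finset.Ico n M, a i ^ 2 * ‖T (U i)‖ ^ 2 := by
      rw [← hfil, Finset.sum_filter]
      refine Finset.sum_congr rfl fun i _ => ?_
      rw [norm_smul, mul_pow, Real.norm_eq_abs, sq_abs]
      simp only [hb]; split_ifs <;> simp
    have h4 := sum_pow_four_le_of_sum_rpow_le hq hp4 hA ha
    have h4' : ∑ i ∈ Finset.Ico n M, a i ^ 4 ≤ A ^ 4 := by
      refine le_trans (Finset.sum_le_sum_of_subset_of_nonneg ?_ fun _ _ _ => by positivity) h4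
      rw [← hfil]; exact Finset.filter_subset _ _
    have hcs := Finset.sum_mul_sq_le_sq_mul_sq (Finset.Ico n M) (fun i => a i ^ 2)
      fun i => ‖T (U i)‖ ^ 2
    simp only [← pow_mul] at hcs
    rw [e1, mul_pow, Real.sq_sqrt (Real.sqrt_nonneg _)]
    refine abs_le_of_sq_le_sq' ?_ (by positivity) |>.2
    refine hcs.trans ?_
    rw [mul_pow, Real.sq_sqrt hV0, ← pow_mul]
    exact mul_le_mul h4' hV (by positivity) (by positivity)
  rw [← Real.rpow_le_rpow_iff (norm_nonneg _) (by positivity) hq]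
  calc _ ≤ 3 * (∑ i ∈ Finset.range M, ‖b i • T (U i)‖ ^ 2) ^ (q / 2) := hmain
    _ ≤ 3 * ((A * √√V) ^ 2) ^ (q / 2) := by gcongr
    _ = 3 * (A * √√V) ^ q := by
        rw [← Real.rpow_natCast, ← Real.rpow_mul (by positivity)]
        congr 2; push_cast; ring
    _ ≤ 3 ^ q * (A * √√V) ^ q := by
        gcongr
        calc (3 : ℝ) = 3 ^ (1 : ℝ) := (Real.rpow_one 3).symm
          _ ≤ 3 ^ q := Real.rpow_le_rpow_of_exponent_le (by norm_num) (by linarith)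
    _ = _ := (Real.mul_rpow (by norm_num) (by positivity)).symm

end BlockBasis

theorem mainTheorem8 (p : ℝ≥0∞) [Fact (1 ≤ p)] (hp2 : 2 < p) (hp4 : p ≤ 4)
    (f : Lp ℝ p (volume : Measure ℝ)) (lam : ℕ → ℝ)
    (hf : IsUnconditionalBasicSeq (fun i => translateLp p (lam i) f))
    (e : ℕ ≃ ℤ × ℕ) :
    ∃ g : ℕ → Lp ℝ p (volume : Measure ℝ),
      IsBasicSeq g ∧
      SeqEquiv (fun i => translateLp p (lam i) f) g ∧
      IsBlockBasisOf g (fun n => haarLp p (e n).1 (e n).2) ∧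
      ∀ I : Set ℝ, I.OrdConnected → Bornology.IsBounded I →
        IsCompactOperator (restrictionOp p I (closedSpan g)) := by
  have hp : p ≠ ∞ := (hp4.trans_lt (by norm_num)).ne
  have hq := toReal_pos_of_one_le hp
  have hq2 : 2 ≤ p.toReal := by
    have := ENNReal.toReal_mono hp hp2.le
    simpa using this
  have hq4 : p.toReal ≤ 4 := by
    have := ENNReal.toReal_mono (by norm_num) hp4
    simpa using this
  set x : ℕ → Lp ℝ p (volume : Measure ℝ) := fun i => translateLp p (lam i) f with hx
  set B := ‖f‖ with hBdef
  have hxB : ∀ i, ‖x i‖ = B := fun i => norm_translateLp (lam i) f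
  have hB : 0 < B := by rw [← hxB 0]; exact norm_pos_iff.mpr (hf.ne_zero 0)
  obtain ⟨K, hK0, hK⟩ := hf.exists_norm_sum_le
  obtain ⟨δ, hδ, hsep⟩ := exists_separation hp hf
  have happ := fun i => exists_dyadicConst_norm_sub_le hp (x i)
    (ε := B / (8 * K ^ 2) * (1 / 2) ^ i) (by positivity)
  choose u k R hmem hu hR hclose using happ
  set U : ℕ → Lp ℝ p (volume : Measure ℝ) := fun i => (hmem i).toLp (u i)
  have hU : ∀ i, U i =ᵐ[volume] u i := fun i => (hmem i).coeFn_toLp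
  obtain ⟨N, n, a, g, hN, hn, hNk, hgsum, hg⟩ := exists_block_modulate (p := p) e hu hR
  -- two-sided estimates on initial segments
  set c := 1 / (4 * K) with hc
  set C := 2 * K + 1 / (4 * K) with hC
  have hc0 : 0 < c := by positivity
  have hC0 : 0 < C := by positivity
  have hbounds : ∀ (m : ℕ) (b : ℕ → ℝ),
      c * ‖∑ i ∈ Finset.range m, b i • x i‖ ≤ ‖∑ i ∈ Finset.range m, b i • g i‖ ∧
        ‖∑ i ∈ Finset.range m, b i • g i‖ ≤ C * ‖∑ i ∈ Finset.range m, b i • x i‖ := by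
    intro m b
    have h := norm_rpow_sum_modulate hp hN hu hNk (J := Set.univ) (fun _ _ _ => rfl) hg hU b m
    rw [norm_LpToLpRestrictCLM_univ] at h
    simp only [← map_smul, ← map_sum, norm_LpToLpRestrictCLM_univ] at h
    exact bounds_of_two_pow_mul_rpow_eq hq (norm_nonneg _) (by positivity) (by positivity) h
      (fun t => (norm_sum_signOf_perturb hK0 hB hxB hK hclose _ t b).1)
      (fun t => (norm_sum_signOf_perturb hK0 hB hxB hK hclose _ t b).2)
  have hequiv : ∀ (s : Finset ℕ) (b : ℕ → ℝ),
      c * ‖∑ i ∈ s, b i • x i‖ ≤ ‖∑ i ∈ s, b i • g i‖ ∧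
        ‖∑ i ∈ s, b i • g i‖ ≤ C * ‖∑ i ∈ s, b i • x i‖ := by
    intro s b
    obtain ⟨m, b', hb'⟩ := sum_finset_eq_sum_range (E := Lp ℝ p (volume : Measure ℝ)) s b
    rw [hb', hb']
    exact hbounds m b'
  have hg0 : ∀ i, g i ≠ 0 := by
    intro i h0
    have h := (hequiv {i} fun _ => 1).1
    simp only [Finset.sum_singleton, one_smul, h0, norm_zero, hxB] at h
    exact absurd h (not_le.mpr (by positivity))
  have hbasic : IsBasicSeq g := by
    refine isBasicSeq_of_norm_sum_range_le hg0 (K := C * K / c) (by positivity) fun m l b hml => ?_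
    have h1 := hK (Finset.range l) (Finset.range m) b (Finset.range_mono hml)
    calc _ ≤ C * ‖∑ i ∈ Finset.range m, b i • x i‖ := (hbounds m b).2
      _ ≤ C * (K * (‖∑ i ∈ Finset.range l, b i • g i‖ / c)) := by
          gcongr
          refine h1.trans ?_
          gcongr
          rw [le_div_iff₀ hc0, mul_comm]
          exact (hbounds l b).1
      _ = _ := by ring
  refine ⟨g, hbasic, ⟨c, C, hc0, hC0, hequiv⟩, ⟨n, a, hn, fun i => ⟨hg0 i, hgsum i⟩⟩, ?_⟩
  intro I _ hI
  obtain ⟨r, hr⟩ := hI.subset_closedBall 0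
  obtain ⟨M, hM⟩ := exists_nat_gt r
  set J := Set.Ico (-M : ℝ) M with hJdef
  have hIJ : I ⊆ J := by
    intro y hy
    have h := hr hy
    rw [mem_closedBall_zero_iff, Real.norm_eq_abs, abs_le] at h
    exact ⟨by linarith, by linarith⟩
  set T := LpToLpRestrictCLM ℝ ℝ ℝ volume p J with hT
  -- the norms of the `U i` on `J` are in `ℓ_4`
  have hsum4 : Summable fun i => ‖T (U i)‖ ^ 4 := by
    obtain ⟨D, hD0, hD⟩ := exists_sum_norm_restrict_translateLp_le hp f hδ hsep M
    have h1 : Summable fun i => ‖T (x i)‖ ^ 4 := by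
      refine summable_of_sum_le (c := (D ^ (1 / p.toReal)) ^ 4) (fun _ => by positivity) fun s => ?_
      refine sum_pow_four_le_of_sum_rpow_le hq hq4 (by positivity) ?_
      simp only [abs_norm]
      rw [← Real.rpow_mul hD0, one_div, inv_mul_cancel₀ hq.ne', Real.rpow_one]
      exact hD s
    have h2 : Summable fun i : ℕ => (B / (8 * K ^ 2) * (1 / 2) ^ i) ^ 4 := by
      simp only [mul_pow, ← pow_mul, mul_comm _ 4]
      simp only [pow_mul]
      exact (summable_geometric_of_lt_one (by norm_num) (by norm_num)).mul_left _
    refine Summable.of_nonneg_of_le (fun _ => by positivity) (fun i => ?_)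
      ((h1.add h2).mul_left (2 ^ 3))
    have h3 : ‖T (U i)‖ ≤ ‖T (x i)‖ + B / (8 * K ^ 2) * (1 / 2) ^ i := by
      have h4 : T (U i) = T (x i) - T (x i - U i) := by rw [map_sub]; abel
      rw [h4]
      exact (norm_sub_le _ _).trans (add_le_add le_rfl
        ((norm_LpToLpRestrictCLM_le J _).trans (hclose i)))
    exact (pow_le_pow_left₀ (norm_nonneg _) h3 4).trans (add_pow_le (norm_nonneg _)
      (by positivity) 4)
  set W : ℕ → ℝ := fun m => ∑' i, ‖T (U (i + m))‖ ^ 4 with hW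
  have hWt : Filter.Tendsto W Filter.atTop (nhds 0) :=
    tendsto_sum_nat_add fun i => ‖T (U i)‖ ^ 4
  set τ : ℕ → ℝ := fun m => 3 * (2 * K / (c * B) * √√(W m)) with hτ
  have hτt : Filter.Tendsto τ Filter.atTop (nhds 0) := by
    have h := ((hWt.sqrt.sqrt).const_mul (2 * K / (c * B))).const_mul 3
    simpa using h
  refine hbasic.isCompactOperator (LpToLpRestrictCLM ℝ ℝ ℝ volume p I) hτt
    (fun m => by positivity) fun m l b hml => ?_
  refine (norm_LpToLpRestrictCLM_mono hIJ _).trans ?_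
  -- the coefficients are controlled in `ℓ_q` by the cotype inequality and unconditionality
  set Y := ‖∑ i ∈ Finset.range l, b i • g i‖ with hY
  set A := 2 * K / (c * B) * Y with hA
  have hA0 : 0 ≤ A := by positivity
  have hcot : ∑ i ∈ Finset.range l, |b i| ^ p.toReal ≤ A ^ p.toReal := by
    have h1 := sum_norm_rpow_le_sum_signOf hp hq2 (Finset.range l) fun i => b i • x i
    rw [Finset.card_range] at h1
    have h2 : ∀ t : Finset ℕ, ‖∑ i ∈ Finset.range l, signOf t i • b i • x i‖ ≤ A * B := by
      intro t
      have h3 := norm_sum_signOf_le hK (Finset.range l) t b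
      simp only [smul_smul, mul_comm (signOf t _)]
      refine h3.trans ?_
      have h4 := (hbounds l b).1
      rw [← le_div_iff₀' hc0] at h4
      calc _ ≤ 2 * K * (Y / c) := by gcongr
        _ = A * B := by rw [hA]; field_simp
    have h5 : ∑ t ∈ (Finset.range l).powerset,
        ‖∑ i ∈ Finset.range l, signOf t i • b i • x i‖ ^ p.toReal
          ≤ 2 ^ l * (A * B) ^ p.toReal := by
      refine (Finset.sum_le_sum fun t _ =>
        Real.rpow_le_rpow (norm_nonneg _) (h2 t) hq.le).trans (le_of_eq ?_)
      simp
    have h6 := le_of_mul_le_mul_left (h1.trans h5) (by positivity : (0 : ℝ) < 2 ^ l)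
    simp only [norm_smul, hxB, Real.norm_eq_abs, Real.mul_rpow (abs_nonneg _) hB.le,
      Real.mul_rpow hA0 hB.le, ← Finset.sum_mul] at h6
    exact le_of_mul_le_mul_right h6 (by positivity)
  have hV : ∑ i ∈ Finset.Ico m l, ‖T (U i)‖ ^ 4 ≤ W m := by
    rw [Finset.sum_Ico_eq_sum_range]
    simp only [add_comm m]
    exact ((summable_nat_add_iff m).mpr hsum4).sum_le_tsum _ fun _ _ => by positivity
  have h := norm_restrict_sum_modulate_le hp hq2 hq4 hN hu hNk (dyadicConst_mem_Ico M) hg hU hA0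
    hcot hV
  refine h.trans (le_of_eq ?_)
  simp only [hτ, hA]
  ring
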